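/- Let $B_m$ be the Bernoulli numbers, $\frac{x}{e^x-1}=\sum_{m\ge 0}\frac{B_m}{m!}x^m$, let $S_k^{(1)}(l)$ be the (signed) Stirling numbers of the first kind, defined by $x(x+1)\cdots(x+k-1)=(-1)^k\sum_{l=0}^{k}(-1)^l S_k^{(1)}(l)\,x^l$, and let $\gamma_1=\lim_{m\to\infty}\bigl(\sum_{k=1}^{m}\frac{\log k}{k}-\frac12\log(m)^2\bigr)$ be the first Stieltjes constant. For every integer $n\ge 1$, both series below converge absolutely and $$\sum_{k=1}^{n}\frac{\log k}{k}=\frac12\log(n)^2+\frac{\log n}{2n}+\gamma_1+\sum_{k=1}^{\infty}\frac{(-1)^k\sum_{l=1}^{k}\frac{(-1)^l}{(l+1)!}B_{l+1}S_{l+1}^{(1)}(2)S_k^{(1)}(l)}{n(n+1)(n+2)\cdots(n+k)}+\log(n)\sum_{k=1}^{\infty}\frac{(-1)^k\sum_{l=1}^{k}\frac{1}{l+1}B_{l+1}S_k^{(1)}(l)}{n(n+1)(n+2)\cdots(n+k)}.$$ The numerators of the terms $k=1,2,3,4$ are $\frac1{12},\frac1{12},\frac{109}{720},\frac{49}{120}$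 in the first series and $-\frac1{12},-\frac1{12},-\frac{19}{120},-\frac{9}{20}$ in the second, i.e. $$\begin{aligned}\sum_{k=1}^{n}\frac{\log k}{k}&=\frac12\log(n)^2+\frac{\log n}{2n}+\gamma_1+\frac{1}{12n(n+1)}+\frac{1}{12n(n+1)(n+2)}+\frac{109}{720n(n+1)(n+2)(n+3)}+\frac{49}{120n(n+1)(n+2)(n+3)(n+4)}+\cdots\\&\quad-\frac{\log n}{12n(n+1)}-\frac{\log n}{12n(n+1)(n+2)}-\frac{19\log n}{120n(n+1)(n+2)(n+3)}-\frac{9\log n}{20n(n+1)(n+2)(n+3)(n+4)}-\cdots.\end{aligned}$$ -/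

import Mathlib

namespace SecondLogSum

open Filter Topology

/-- Signed Stirling numbers of the first kind `S_k^{(1)}(l)`, obtained from Mathlib's unsigned
ones. The identity that defines them is `pochhammer_eq_sum_stirlingS` below. -/
def stirlingS (k l : ℕ) : ℤ := (-1) ^ (k + l) * (Nat.stirlingFirst k l : ℤ)

theorem pochhammer_eq_sum_stirlingFirst {R : Type*} [CommRing R] (x : R) (k : ℕ) :
    (ascPochhammer R k).eval x =
      ∑ l ∈ Finset.range (k + 1), (Nat.stirlingFirst k l : R) * x ^ l := by
  induction k with
  | zero => simp
  | succ k ih =>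
    rw [ascPochhammer_succ_eval, ih, Finset.sum_range_succ' _ (k + 1)]
    simp only [Nat.stirlingFirst_succ_succ, Nat.stirlingFirst_succ_zero, Nat.cast_add, Nat.cast_mul,
      add_mul, Finset.sum_add_distrib, Nat.cast_zero, zero_mul, add_zero, mul_add]
    have h1 : ∑ l ∈ Finset.range (k + 1), (k : R) * (Nat.stirlingFirst k (l + 1) : R) * x ^ (l + 1)
        = (∑ l ∈ Finset.range (k + 1), (Nat.stirlingFirst k l : R) * x ^ l) * (k : R) := by
      have h2 := Finset.sum_range_succ' (fun l => (k : R) * (Nat.stirlingFirst k l : R) * x ^ l)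
        (k + 1)
      have h3 := Finset.sum_range_succ (fun l => (k : R) * (Nat.stirlingFirst k l : R) * x ^ l)
        (k + 1)
      have h4 : (k : R) * (Nat.stirlingFirst k 0 : R) = 0 := by
        cases k <;> simp
      rw [Nat.stirlingFirst_eq_zero_of_lt (Nat.lt_succ_self k)] at h3
      simp only [h4, Nat.cast_zero, mul_zero, zero_mul, add_zero] at h2 h3
      rw [← h2, h3, Finset.sum_mul]
      exact Finset.sum_congr rfl fun l _ => by ring
    have h5 : (∑ l ∈ Finset.range (k + 1), (Nat.stirlingFirst k l : R) * x ^ l) * x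
        = ∑ l ∈ Finset.range (k + 1), (Nat.stirlingFirst k l : R) * x ^ (l + 1) := by
      rw [Finset.sum_mul]
      exact Finset.sum_congr rfl fun l _ => by ring
    rw [h1, ← h5]
    ring

/-- The identity `(x)_k = (-1)^k ∑_{l=0}^k (-1)^l S_k^{(1)}(l) x^l`, where
`(x)_k = x (x+1) ⋯ (x+k-1)`. -/
theorem pochhammer_eq_sum_stirlingS {R : Type*} [CommRing R] (x : R) (k : ℕ) :
    (ascPochhammer R k).eval x =
      (-1) ^ k * ∑ l ∈ Finset.range (k + 1), (-1) ^ l * (stirlingS k l : R) * x ^ l := by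
  rw [pochhammer_eq_sum_stirlingFirst, Finset.mul_sum]
  refine Finset.sum_congr rfl fun l _ => ?_
  have hk : ((-1 : R) ^ k) * (-1) ^ k = 1 := by rw [← mul_pow]; simp
  have hl : ((-1 : R) ^ l) * (-1) ^ l = 1 := by rw [← mul_pow]; simp
  simp only [stirlingS, Int.cast_mul, Int.cast_pow, Int.cast_neg, Int.cast_one, Int.cast_natCast,
    pow_add]
  linear_combination (-(Nat.stirlingFirst k l : R) * x ^ l) * hk
    - (Nat.stirlingFirst k l : R) * x ^ l * ((-1 : R) ^ k * (-1) ^ k) * hl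

/-- The sequence `∑_{k=1}^m log k / k - (log m)^2 / 2`. -/
noncomputable def stieltjesOneSeq (m : ℕ) : ℝ :=
  (∑ k ∈ Finset.Icc 1 m, Real.log k / k) - Real.log m ^ 2 / 2

/-- The first Stieltjes constant `γ₁ = lim_{m → ∞} (∑_{k=1}^m log k / k - (log m)^2 / 2)`; the
limit exists by `tendsto_stieltjesOneSeq`. -/
noncomputable def stieltjesOne : ℝ := limUnder atTop stieltjesOneSeq

theorem integral_log_div {a b : ℝ} (ha : 0 < a) (hab : a ≤ b) :
    ∫ x in a..b, Real.log x / x = Real.log b ^ 2 / 2 - Real.log a ^ 2 / 2 := by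
  have hpos : ∀ x ∈ Set.uIcc a b, x ≠ 0 := by
    intro x hx
    rw [Set.uIcc_of_le hab] at hx
    exact (ha.trans_le hx.1).ne'
  refine intervalIntegral.integral_eq_sub_of_hasDerivAt
    (f := fun x => Real.log x ^ 2 / 2) (fun x hx => ?_) ?_
  · convert! ((Real.hasDerivAt_log (hpos x hx)).pow 2).div_const 2 using 1
    simp only [Nat.cast_ofNat, Nat.add_one_sub_one, pow_one]
    ring
  · refine ContinuousOn.intervalIntegrable ?_
    exact (Real.continuousOn_log.mono fun x hx => hpos x hx).div continuousOn_id hpos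

theorem antitoneOn_log_div (a b : ℕ) (ha : 3 ≤ a) :
    AntitoneOn (fun x : ℝ => Real.log x / x) (Set.Icc a b) := by
  refine Real.log_div_self_antitoneOn.mono fun x hx => ?_
  have h3 : (3 : ℝ) ≤ a := by exact_mod_cast ha
  exact (Real.exp_one_lt_three.le.trans h3).trans hx.1

theorem tendsto_stieltjesOneSeq : Tendsto stieltjesOneSeq atTop (𝓝 stieltjesOne) := by
  have hanti : Antitone fun m => stieltjesOneSeq (m + 3) := by
    refine antitone_nat_of_succ_le fun m => ?_
    have h := AntitoneOn.sum_le_integral_Ico (Nat.le_succ (m + 3))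
      (antitoneOn_log_div (m + 3) (m + 3 + 1) (by omega))
    rw [integral_log_div (by positivity) (by push_cast; linarith)] at h
    simp only [Nat.succ_eq_add_one, Nat.Ico_succ_singleton, Finset.sum_singleton] at h
    have e : m + 1 + 3 = m + 3 + 1 := by ring
    simp only [stieltjesOneSeq, e]
    rw [Finset.sum_Icc_succ_top (by omega)]
    linarith
  have hbdd : BddBelow (Set.range fun m => stieltjesOneSeq (m + 3)) := by
    refine ⟨-(Real.log 3 ^ 2 / 2), ?_⟩
    rintro _ ⟨m, rfl⟩
    have h := AntitoneOn.integral_le_sum_Ico (show 3 ≤ m + 3 by omega)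
      (antitoneOn_log_div 3 (m + 3) le_rfl)
    rw [integral_log_div (by positivity) (by push_cast; linarith [(Nat.cast_nonneg m : (0:ℝ) ≤ m)])]
      at h
    have hs : ∑ x ∈ Finset.Ico 3 (m + 3), Real.log (x : ℝ) / x
        ≤ ∑ k ∈ Finset.Icc 1 (m + 3), Real.log (k : ℝ) / k := by
      refine Finset.sum_le_sum_of_subset_of_nonneg (fun x hx => ?_) fun x _ _ => ?_
      · simp only [Finset.mem_Ico, Finset.mem_Icc] at hx ⊢
        omega
      · exact div_nonneg (Real.log_natCast_nonneg x) (Nat.cast_nonneg x)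
    simp only [stieltjesOneSeq]
    push_cast at h hs ⊢
    linarith
  have h := tendsto_atTop_ciInf hanti hbdd
  exact tendsto_nhds_limUnder ⟨_, (tendsto_add_atTop_iff_nat 3).1 h⟩

/-- `(-1)^k ∑_{l=1}^k (-1)^l / (l+1)! * B_{l+1} S_{l+1}^{(1)}(2) S_k^{(1)}(l)`
(`bernoulli` is the convention `B_1 = -1/2`). -/
noncomputable def coeffA (k : ℕ) : ℝ :=
  (-1) ^ k * ∑ l ∈ Finset.Icc 1 k, (-1) ^ l / ((l + 1).factorial : ℝ)
    * (bernoulli (l + 1) : ℝ) * (stirlingS (l + 1) 2 : ℝ) * (stirlingS k l : ℝ)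

/-- `(-1)^k ∑_{l=1}^k 1 / (l+1) * B_{l+1} S_k^{(1)}(l)`. -/
noncomputable def coeffB (k : ℕ) : ℝ :=
  (-1) ^ k * ∑ l ∈ Finset.Icc 1 k, 1 / ((l : ℝ) + 1)
    * (bernoulli (l + 1) : ℝ) * (stirlingS k l : ℝ)

/-- The product `n (n+1) (n+2) ⋯ (n+k)`. -/
noncomputable def risingProd (n k : ℕ) : ℝ := ∏ i ∈ Finset.range (k + 1), ((n : ℝ) + i)

end SecondLogSum

/-!
Summing the Abel–Plana formula for `log z / z` over unit steps gives
`∑_{k ≤ n} log k / k = (log n)² / 2 + log n / (2 n) + γ₁ + R n`, where `R n` is the integral over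
`s > 0` of `Im (log (n + is) / (n + is))` against the weight `2 / (exp (2πs) - 1)`. Splitting off
`log n` from the numerator and putting `x = -is`, the integrand is governed by `1 / (n - x)` and
`(log n - log (n - x)) / (n - x)`. These have the factorial series `∑ (x)_k / (n)_{k+1}` and
`∑ h_k(x) / (n)_{k+1}`, where `h_k` is the rising factorial `(x)_k` with the coefficient of `x ^ l`
multiplied by the harmonic number `H_l`; the second follows from the first, integrated along the
segment from `0` to `x`, by way of the recursion `h_{k+1}(x) = (x + k) h_k(x) + x ∫₀¹ (t x)_k dt`.
Since the moments of the weight are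
`∫ Im ((is) ^ l) * 2 / (exp (2πs) - 1) ds = B_{l+1} / (l + 1)` for `l ≥ 1`, and
`S_{l+1}^{(1)}(2) = ± l! H_l`, integration term by term produces the two series of the theorem. It
is justified by the bound `|(-is)_{j+1}| ≤ j! s exp (πs / 2)`, a consequence of Euler's product
for the sine.
-/

namespace SecondLogSum

open Filter Topology MeasureTheory Set

/-- The Abel–Plana weight `2 / (exp (2πs) - 1)`, against which the imaginary part of a function on
a vertical line is integrated. -/
noncomputable def abelWeight (s : ℝ) : ℝ := 2 / (Real.exp (2 * Real.pi * s) - 1)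

/-- The correction term at `a` in the Abel–Plana summation formula for a function `f` that is real
on the real line: the integral of `-i (f (a + is) - f (a - is)) / (exp (2πs) - 1)`, written with
the imaginary part of `f (a + is)` since `f (a - is)` is its conjugate. -/
noncomputable def abelPlanaCorrection (f : ℂ → ℂ) (a : ℝ) : ℝ :=
  ∫ s in Ioi (0 : ℝ), (f (a + s * Complex.I)).im * abelWeight s

/-- The closed half-strip `a ≤ Re z ≤ a + 1`, `0 ≤ Im z`, on which the Abel–Plana formula for one
step is obtained from Cauchy's theorem. -/
def halfStrip (a : ℝ) : Set ℂ := Icc a (a + 1) ×ℂ Ici 0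

theorem mem_halfStrip {a : ℝ} {z : ℂ} :
    z ∈ halfStrip a ↔ (a ≤ z.re ∧ z.re ≤ a + 1) ∧ 0 ≤ z.im := Iff.rfl

theorem add_mul_I_mem_halfStrip {a x s : ℝ} (hx : x ∈ Icc a (a + 1)) (hs : 0 ≤ s) :
    (x + s * Complex.I : ℂ) ∈ halfStrip a := by
  simpa [mem_halfStrip] using And.intro hx hs

theorem ofReal_mem_halfStrip {a x : ℝ} (hx : x ∈ Icc a (a + 1)) : (x : ℂ) ∈ halfStrip a := by
  simpa using add_mul_I_mem_halfStrip hx le_rfl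

/-- The function `exp (-2πiz) - 1`, whose zeros are the integers and which tends to infinity as
`Im z → ∞`; it is real on the vertical lines through the integers. -/
noncomputable def expSubOne (z : ℂ) : ℂ := Complex.exp (-(2 * Real.pi * Complex.I) * z) - 1

theorem hasDerivAt_expSubOne (z : ℂ) :
    HasDerivAt expSubOne
      (Complex.exp (-(2 * Real.pi * Complex.I) * z) * -(2 * Real.pi * Complex.I)) z :=
  (hasDerivAt_const_mul (-(2 * Real.pi * Complex.I)) (x := z)).cexp.sub_const 1

theorem expSubOne_eq_zero_iff {z : ℂ} : expSubOne z = 0 ↔ ∃ m : ℤ, z = m := by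
  rw [expSubOne, sub_eq_zero, Complex.exp_eq_one_iff]
  constructor
  · rintro ⟨m, hm⟩
    refine ⟨-m, mul_right_cancel₀ Complex.two_pi_I_ne_zero ?_⟩
    push_cast
    linear_combination -hm
  · rintro ⟨m, rfl⟩
    exact ⟨-m, by push_cast; ring⟩

theorem expSubOne_ne_zero_of_im_pos {z : ℂ} (hz : 0 < z.im) : expSubOne z ≠ 0 := by
  intro h
  obtain ⟨m, rfl⟩ := expSubOne_eq_zero_iff.1 h
  simp at hz

theorem expSubOne_ofReal_ne_zero {x : ℝ} (hx : x ∈ Ioo 0 1) : expSubOne x ≠ 0 := by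
  intro h
  obtain ⟨m, hm⟩ := expSubOne_eq_zero_iff.1 h
  obtain rfl : x = m := by exact_mod_cast hm
  have h0 : 0 < m := by exact_mod_cast hx.1
  have h1 : m < 1 := by exact_mod_cast hx.2
  omega

theorem expSubOne_intCast_add_mul_I (m : ℤ) (s : ℝ) :
    expSubOne (m + s * Complex.I) = ((Real.exp (2 * Real.pi * s) - 1 : ℝ) : ℂ) := by
  have h : -(2 * Real.pi * Complex.I) * (m + s * Complex.I)
      = ((2 * Real.pi * s : ℝ) : ℂ) + ((-m : ℤ) : ℂ) * (2 * Real.pi * Complex.I) := by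
    push_cast
    linear_combination (-2 * (Real.pi : ℂ) * s) * Complex.I_sq
  rw [expSubOne, h, Complex.exp_periodic.int_mul, Complex.ofReal_sub, Complex.ofReal_exp,
    Complex.ofReal_one]

theorem exp_le_two_mul_norm_expSubOne {z : ℂ} (hz : 1 ≤ z.im) :
    Real.exp (2 * Real.pi * z.im) ≤ 2 * ‖expSubOne z‖ := by
  have hnorm : ‖Complex.exp (-(2 * Real.pi * Complex.I) * z)‖ = Real.exp (2 * Real.pi * z.im) := by
    simp [Complex.norm_exp]
  have hsub := norm_sub_norm_le (Complex.exp (-(2 * Real.pi * Complex.I) * z)) 1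
  rw [hnorm, norm_one] at hsub
  have htwo : 2 ≤ Real.exp (2 * Real.pi * z.im) := by
    nlinarith [Real.add_one_le_exp (2 * Real.pi * z.im), Real.pi_gt_three]
  rw [expSubOne]
  linarith

theorem div_expSubOne_re {x : ℝ} (hx : expSubOne x ≠ 0) {w : ℂ} (hw : w.im = 0) :
    (w / expSubOne x).re = -(1 / 2) * w.re := by
  have he : expSubOne x = ⟨Real.cos (2 * Real.pi * x) - 1, -Real.sin (2 * Real.pi * x)⟩ := by
    have : -(2 * Real.pi * Complex.I) * x = ((-(2 * Real.pi * x) : ℝ) : ℂ) * Complex.I := by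
      push_cast; ring
    rw [expSubOne, this]
    apply Complex.ext
    · rw [Complex.sub_re, Complex.exp_ofReal_mul_I_re, Real.cos_neg, Complex.one_re]
    · rw [Complex.sub_im, Complex.exp_ofReal_mul_I_im, Real.sin_neg, Complex.one_im, sub_zero]
  have hn : Complex.normSq (expSubOne x) = 2 - 2 * Real.cos (2 * Real.pi * x) := by
    rw [he, Complex.normSq_mk]
    nlinarith [Real.sin_sq_add_cos_sq (2 * Real.pi * x)]
  have hn0 : 2 - 2 * Real.cos (2 * Real.pi * x) ≠ 0 := by
    rwa [← hn, ne_eq, Complex.normSq_eq_zero]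
  rw [Complex.div_re, hw, zero_mul, zero_div, add_zero, hn, he, div_eq_iff hn0]
  ring

theorem tendsto_div_of_hasDerivAt_of_eq_zero {𝕜 : Type*} [NontriviallyNormedField 𝕜]
    {f g : 𝕜 → 𝕜} {f' g' x : 𝕜} (hf : HasDerivAt f f' x) (hg : HasDerivAt g g' x) (hf0 : f x = 0)
    (hg0 : g x = 0) (hg' : g' ≠ 0) : Tendsto (fun y => f y / g y) (𝓝[≠] x) (𝓝 (f' / g')) := by
  refine ((hasDerivAt_iff_tendsto_slope.1 hf).div (hasDerivAt_iff_tendsto_slope.1 hg) hg').congr' ?_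
  filter_upwards [self_mem_nhdsWithin] with y hy
  simp only [Pi.div_apply, slope_def_field, hf0, hg0, sub_zero]
  exact div_div_div_cancel_right₀ (sub_ne_zero.2 hy) _ _

open Classical in
/-- The quotient `h / (exp (-2πiz) - 1)`, given its limit by L'Hôpital's rule at the zeros of the
denominator so that it is continuous wherever `h` vanishes there. -/
noncomputable def abelQuotient (h : ℂ → ℂ) (z : ℂ) : ℂ :=
  if expSubOne z = 0 then deriv h z / deriv expSubOne z else h z / expSubOne z

theorem abelQuotient_of_ne {h : ℂ → ℂ} {z : ℂ} (hz : expSubOne z ≠ 0) :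
    abelQuotient h z = h z / expSubOne z := if_neg hz

theorem differentiableAt_abelQuotient {h : ℂ → ℂ} {z : ℂ} (hh : DifferentiableAt ℂ h z)
    (hz : expSubOne z ≠ 0) : DifferentiableAt ℂ (abelQuotient h) z := by
  refine (hh.div (hasDerivAt_expSubOne z).differentiableAt hz).congr_of_eventuallyEq ?_
  filter_upwards [(hasDerivAt_expSubOne z).continuousAt.eventually_ne hz] with w hw
  exact abelQuotient_of_ne hw

theorem continuousAt_abelQuotient {h : ℂ → ℂ} {z : ℂ} (hh : DifferentiableAt ℂ h z)
    (h0 : expSubOne z = 0 → h z = 0) : ContinuousAt (abelQuotient h) z := by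
  by_cases hz : expSubOne z = 0
  · have hderiv : deriv expSubOne z ≠ 0 := by
      rw [(hasDerivAt_expSubOne z).deriv]
      exact mul_ne_zero (Complex.exp_ne_zero _) (neg_ne_zero.2 Complex.two_pi_I_ne_zero)
    have he := (hasDerivAt_expSubOne z).differentiableAt.hasDerivAt
    rw [continuousAt_iff_punctured_nhds, show abelQuotient h z = _ from if_pos hz]
    refine (tendsto_div_of_hasDerivAt_of_eq_zero hh.hasDerivAt he (h0 hz) hz hderiv).congr' ?_
    filter_upwards [he.eventually_ne hderiv] with w hw
    exact (abelQuotient_of_ne (by simpa [hz] using hw)).symm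
  · exact (differentiableAt_abelQuotient hh hz).continuousAt

theorem norm_abelQuotient_le {h : ℂ → ℂ} {z : ℂ} {C c : ℝ} (hz : 1 ≤ z.im)
    (hC : ‖h z‖ ≤ C * Real.exp (c * z.im)) :
    ‖abelQuotient h z‖ ≤ 2 * C * Real.exp (-(2 * Real.pi - c) * z.im) := by
  have hlow := exp_le_two_mul_norm_expSubOne hz
  have hne := expSubOne_ne_zero_of_im_pos (zero_lt_one.trans_le hz)
  have hexp : Real.exp (c * z.im)
      = Real.exp (-(2 * Real.pi - c) * z.im) * Real.exp (2 * Real.pi * z.im) := by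
    rw [← Real.exp_add]; ring_nf
  have hC0 : 0 ≤ C := nonneg_of_mul_nonneg_left ((norm_nonneg _).trans hC) (Real.exp_pos _)
  rw [abelQuotient_of_ne hne, norm_div, div_le_iff₀ (norm_pos_iff.2 hne)]
  calc ‖h z‖ ≤ C * Real.exp (-(2 * Real.pi - c) * z.im) * Real.exp (2 * Real.pi * z.im) := by
        rwa [mul_assoc, ← hexp]
    _ ≤ C * Real.exp (-(2 * Real.pi - c) * z.im) * (2 * ‖expSubOne z‖) := by gcongr
    _ = 2 * C * Real.exp (-(2 * Real.pi - c) * z.im) * ‖expSubOne z‖ := by ring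

theorem integrableOn_abelQuotient {h : ℂ → ℂ} {x C c : ℝ} (hc : c < 2 * Real.pi)
    (hcont : ∀ s : ℝ, 0 ≤ s → ContinuousAt (abelQuotient h) (x + s * Complex.I))
    (hC : ∀ s : ℝ, 0 ≤ s → ‖h (x + s * Complex.I)‖ ≤ C * Real.exp (c * s)) :
    IntegrableOn (fun s : ℝ => abelQuotient h (x + s * Complex.I)) (Ioi 0) := by
  have hloc : ContinuousOn (fun s : ℝ => abelQuotient h (x + s * Complex.I)) (Ici 0) := fun s hs =>
    (ContinuousAt.comp (f := fun s : ℝ => (x : ℂ) + s * Complex.I) (hcont s hs)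
      (by fun_prop)).continuousWithinAt
  have hbig : (fun s : ℝ => abelQuotient h (x + s * Complex.I)) =O[atTop]
      fun s => Real.exp (-(2 * Real.pi - c) * s) := by
    refine .of_bound (2 * C) ?_
    filter_upwards [eventually_ge_atTop (1 : ℝ)] with s hs
    simpa using norm_abelQuotient_le (h := h) (z := x + s * Complex.I) (c := c) (by simpa)
      (by simpa using hC s (by linarith))
  exact ((hloc.locallyIntegrableOn measurableSet_Ici).integrableOn_of_isBigO_atTop hbig
    ⟨Ioi 0, Ioi_mem_atTop 0, exp_neg_integrableOn_Ioi 0 (sub_pos.2 hc)⟩).mono_set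
      Ioi_subset_Ici_self

theorem two_mul_abelQuotient_im (h : ℂ → ℂ) (m : ℤ) {s : ℝ} (hs : 0 < s) :
    2 * (abelQuotient h (m + s * Complex.I)).im = (h (m + s * Complex.I)).im * abelWeight s := by
  rw [abelQuotient_of_ne (expSubOne_ne_zero_of_im_pos (by simpa)), expSubOne_intCast_add_mul_I,
    Complex.div_ofReal_im, abelWeight]
  ring

theorem abelPlanaCorrection_intCast {h : ℂ → ℂ} {m : ℤ}
    (hint : IntegrableOn (fun s : ℝ => abelQuotient h (m + s * Complex.I)) (Ioi 0)) :
    abelPlanaCorrection h m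
      = 2 * (∫ s in Ioi (0 : ℝ), abelQuotient h (m + s * Complex.I)).im := by
  have him : (∫ s in Ioi (0 : ℝ), abelQuotient h (m + s * Complex.I)).im
      = ∫ s in Ioi (0 : ℝ), (abelQuotient h (m + s * Complex.I)).im :=
    (Complex.imCLM.integral_comp_comm hint).symm
  rw [him, ← integral_const_mul, abelPlanaCorrection]
  refine setIntegral_congr_fun measurableSet_Ioi fun s hs => ?_
  simpa using (two_mul_abelQuotient_im h m hs).symm

theorem integrableOn_im_mul_abelWeight {f : ℂ → ℂ} {a C c : ℝ} (hc0 : 0 ≤ c)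
    (hc : c < 2 * Real.pi) (hd : ∀ s : ℝ, 0 ≤ s → DifferentiableAt ℂ f (a + s * Complex.I))
    (hC : ∀ s : ℝ, 0 ≤ s → ‖f (a + s * Complex.I)‖ ≤ C * Real.exp (c * s)) (hr : (f a).im = 0) :
    IntegrableOn (fun s : ℝ => (f (a + s * Complex.I)).im * abelWeight s) (Ioi 0) := by
  -- Subtracting `f a` does not change the imaginary part and makes the pole at `s = 0` removable.
  let h : ℂ → ℂ := fun z => f (a + z) - f a
  have hint : IntegrableOn (fun s : ℝ => abelQuotient h ((0 : ℝ) + s * Complex.I)) (Ioi 0) := by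
    refine integrableOn_abelQuotient (C := 2 * C) hc (fun s hs => ?_) fun s hs => ?_
    · refine continuousAt_abelQuotient ?_ fun hz => ?_
      · refine (DifferentiableAt.comp (f := fun z => (a : ℂ) + z) _ ?_ (by fun_prop)).sub_const _
        simpa using hd s hs
      · obtain rfl : s = 0 := by
          by_contra hne
          exact expSubOne_ne_zero_of_im_pos (by simpa using hs.lt_of_ne' hne) hz
        simp [h]
    · have hfa : ‖f a‖ ≤ C := by simpa using hC 0 le_rfl
      have hone : 1 ≤ Real.exp (c * s) := Real.one_le_exp (by positivity)
      calc ‖h ((0 : ℝ) + s * Complex.I)‖ ≤ ‖f (a + s * Complex.I)‖ + ‖f a‖ := by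
            simpa [h] using norm_sub_le (f (a + s * Complex.I)) (f a)
        _ ≤ C * Real.exp (c * s) + C * Real.exp (c * s) :=
          add_le_add (hC s hs) (hfa.trans (le_mul_of_one_le_right ((norm_nonneg _).trans hfa) hone))
        _ = 2 * C * Real.exp (c * s) := by ring
  refine ((Complex.imCLM.integrable_comp hint).const_mul 2).congr ?_
  filter_upwards [ae_restrict_mem measurableSet_Ioi] with s hs
  simpa [h, hr] using two_mul_abelQuotient_im h 0 hs

theorem integral_vertical_sub_integral_vertical {q : ℂ → ℂ} {a : ℝ}
    (hcont : ContinuousOn q (halfStrip a))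
    (hd : ∀ z ∈ halfStrip a, 0 < z.im → DifferentiableAt ℂ q z)
    (htop : Tendsto (fun T : ℝ => ∫ x in a..a + 1, q (x + T * Complex.I)) atTop (𝓝 0))
    (hleft : IntegrableOn (fun s : ℝ => q (a + s * Complex.I)) (Ioi 0))
    (hright : IntegrableOn (fun s : ℝ => q ((a + 1 : ℝ) + s * Complex.I)) (Ioi 0)) :
    (∫ s in Ioi (0 : ℝ), q (a + s * Complex.I))
        - ∫ s in Ioi (0 : ℝ), q ((a + 1 : ℝ) + s * Complex.I)
      = -Complex.I * ∫ x in a..a + 1, q x := by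
  have hrect : ∀ T : ℝ, 0 < T →
      (∫ s in (0 : ℝ)..T, q (a + s * Complex.I))
          - ∫ s in (0 : ℝ)..T, q ((a + 1 : ℝ) + s * Complex.I)
        = -Complex.I * ((∫ x in a..a + 1, q x) - ∫ x in a..a + 1, q (x + T * Complex.I)) := by
    intro T hT
    have hcauchy := Complex.integral_boundary_rect_eq_zero_of_continuousOn_of_differentiableOn q a
      ((a + 1 : ℝ) + T * Complex.I) (hcont.mono fun z hz => ?_) fun z hz => ?_
    · simp only [Complex.ofReal_re, Complex.ofReal_im, Complex.add_re, Complex.add_im,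
        Complex.re_ofReal_mul, Complex.im_ofReal_mul, Complex.I_re, Complex.I_im, mul_zero,
        mul_one, add_zero, zero_add, Complex.ofReal_zero, zero_mul, smul_eq_mul] at hcauchy
      linear_combination Complex.I * hcauchy
        + ((∫ s in (0 : ℝ)..T, q (a + s * Complex.I))
          - ∫ s in (0 : ℝ)..T, q ((a + 1 : ℝ) + s * Complex.I)) * Complex.I_sq
    · simp only [Complex.mem_reProdIm, Complex.ofReal_re, Complex.ofReal_im, Complex.add_re,
        Complex.add_im, Complex.re_ofReal_mul, Complex.im_ofReal_mul, Complex.I_re, Complex.I_im,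
        mul_zero, mul_one, add_zero, zero_add, uIcc_of_le hT.le,
        uIcc_of_le (le_add_of_nonneg_right zero_le_one : a ≤ a + 1)] at hz
      exact ⟨hz.1, hz.2.1⟩
    · simp only [Complex.mem_reProdIm, Complex.ofReal_re, Complex.ofReal_im, Complex.add_re,
        Complex.add_im, Complex.re_ofReal_mul, Complex.im_ofReal_mul, Complex.I_re, Complex.I_im,
        mul_zero, mul_one, add_zero, zero_add, min_eq_left hT.le, max_eq_right hT.le,
        min_eq_left (le_add_of_nonneg_right zero_le_one : a ≤ a + 1),
        max_eq_right (le_add_of_nonneg_right zero_le_one : a ≤ a + 1)] at hz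
      exact (hd z ⟨Ioo_subset_Icc_self hz.1, hz.2.1.le⟩ hz.2.1).differentiableWithinAt
  have hsides := (intervalIntegral_tendsto_integral_Ioi 0 hleft tendsto_id).sub
    (intervalIntegral_tendsto_integral_Ioi 0 hright tendsto_id)
  have hlim := (htop.const_sub (∫ x in a..a + 1, q x)).const_mul (-Complex.I)
  rw [sub_zero] at hlim
  exact tendsto_nhds_unique_of_eventuallyEq hsides hlim ((eventually_gt_atTop 0).mono hrect)

theorem eq_zero_of_expSubOne_eq_zero {h : ℂ → ℂ} (h0 : h 0 = 0) (h1 : h 1 = 0) {z : ℂ}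
    (hz : z ∈ halfStrip 0) (he : expSubOne z = 0) : h z = 0 := by
  obtain ⟨m, rfl⟩ := expSubOne_eq_zero_iff.1 he
  simp only [mem_halfStrip, Complex.intCast_re, zero_add] at hz
  have hm0 : 0 ≤ m := by exact_mod_cast hz.1.1
  have hm1 : m ≤ 1 := by exact_mod_cast hz.1.2
  obtain rfl | rfl : m = 0 ∨ m = 1 := by omega
  · simpa using h0
  · simpa using h1

theorem tendsto_integral_abelQuotient_add_mul_I {h : ℂ → ℂ} {a C c : ℝ} (hc : c < 2 * Real.pi)
    (hC : ∀ z ∈ halfStrip a, ‖h z‖ ≤ C * Real.exp (c * z.im)) :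
    Tendsto (fun T : ℝ => ∫ x in a..a + 1, abelQuotient h (x + T * Complex.I)) atTop (𝓝 0) := by
  have hexp : Tendsto (fun T : ℝ => 2 * C * Real.exp (-(2 * Real.pi - c) * T)) atTop (𝓝 0) := by
    rw [← mul_zero (2 * C)]
    exact (Real.tendsto_exp_atBot.comp
      (tendsto_id.const_mul_atTop_of_neg (neg_lt_zero.2 (sub_pos.2 hc)))).const_mul _
  refine squeeze_zero_norm' ?_ hexp
  filter_upwards [eventually_ge_atTop (1 : ℝ)] with T hT
  refine (intervalIntegral.norm_integral_le_of_norm_le_const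
    (C := 2 * C * Real.exp (-(2 * Real.pi - c) * T)) fun x hx => ?_).trans (by simp)
  rw [uIoc_of_le (by linarith)] at hx
  simpa using norm_abelQuotient_le (h := h) (z := x + T * Complex.I) (c := c) (by simpa)
    (hC _ (add_mul_I_mem_halfStrip ⟨hx.1.le, hx.2⟩ (by linarith)))

theorem integral_abelQuotient_re {h : ℂ → ℂ}
    (hcont : ContinuousOn (abelQuotient h) (halfStrip 0))
    (hr : ∀ x ∈ Icc (0 : ℝ) 1, (h x).im = 0) :
    (∫ x in (0 : ℝ)..1, abelQuotient h x).re = -(1 / 2) * ∫ x in (0 : ℝ)..1, (h x).re := by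
  have hint : IntervalIntegrable (fun x : ℝ => abelQuotient h x) volume 0 1 := by
    refine ContinuousOn.intervalIntegrable (hcont.comp (by fun_prop) fun x hx => ?_)
    rw [uIcc_of_le zero_le_one] at hx
    exact ofReal_mem_halfStrip (by simpa using hx)
  have hre : (∫ x in (0 : ℝ)..1, abelQuotient h x).re = ∫ x in (0 : ℝ)..1, (abelQuotient h x).re :=
    (Complex.reCLM.intervalIntegral_comp_comm hint).symm
  rw [hre, ← intervalIntegral.integral_const_mul]
  refine intervalIntegral.integral_congr_Ioo_of_le zero_le_one fun x hx => ?_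
  have hne := expSubOne_ofReal_ne_zero hx
  simp only [abelQuotient_of_ne hne, div_expSubOne_re hne (hr x (Ioo_subset_Icc_self hx))]

theorem abelPlanaCorrection_zero_sub_one {h : ℂ → ℂ} {C c : ℝ} (hc : c < 2 * Real.pi)
    (hd : ∀ z ∈ halfStrip 0, DifferentiableAt ℂ h z)
    (hC : ∀ z ∈ halfStrip 0, ‖h z‖ ≤ C * Real.exp (c * z.im))
    (hr : ∀ x ∈ Icc (0 : ℝ) 1, (h x).im = 0) (h0 : h 0 = 0) (h1 : h 1 = 0) :
    abelPlanaCorrection h 0 - abelPlanaCorrection h 1 = ∫ x in (0 : ℝ)..1, (h x).re := by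
  have hcont : ∀ z ∈ halfStrip 0, ContinuousAt (abelQuotient h) z := fun z hz =>
    continuousAt_abelQuotient (hd z hz) (eq_zero_of_expSubOne_eq_zero h0 h1 hz)
  have hcontOn : ContinuousOn (abelQuotient h) (halfStrip 0) :=
    fun z hz => (hcont z hz).continuousWithinAt
  have hint : ∀ x ∈ Icc (0 : ℝ) (0 + 1),
      IntegrableOn (fun s : ℝ => abelQuotient h (x + s * Complex.I)) (Ioi 0) := fun x hx =>
    integrableOn_abelQuotient hc (fun s hs => hcont _ (add_mul_I_mem_halfStrip hx hs))
      fun s hs => by simpa using hC _ (add_mul_I_mem_halfStrip hx hs)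
  have hleft := hint 0 (by simp)
  have hright := hint (0 + 1) (by simp)
  have hstrip := integral_vertical_sub_integral_vertical hcontOn
    (fun z hz him => differentiableAt_abelQuotient (hd z hz) (expSubOne_ne_zero_of_im_pos him))
    (tendsto_integral_abelQuotient_add_mul_I hc hC) hleft hright
  have hcorr0 := abelPlanaCorrection_intCast (h := h) (m := 0) (by simpa using hleft)
  have hcorr1 := abelPlanaCorrection_intCast (h := h) (m := 1) (by simpa using hright)
  have him := congrArg Complex.im hstrip
  simp only [zero_add, Complex.sub_im, neg_mul, Complex.neg_im, Complex.I_mul_im,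
    integral_abelQuotient_re hcontOn hr, Complex.ofReal_zero, Complex.ofReal_one] at him
  simp only [Int.cast_zero, Int.cast_one, zero_add] at hcorr0 hcorr1
  rw [hcorr0, hcorr1]
  linarith

theorem norm_le_mul_exp_im_of_mem_halfStrip {z : ℂ} (hz : z ∈ halfStrip 0) {c : ℝ} (hc : 0 < c) :
    ‖z‖ ≤ (1 + 1 / c) * Real.exp (c * z.im) := by
  obtain ⟨⟨hre0, hre1⟩, him⟩ := mem_halfStrip.1 hz
  have hnorm : ‖z‖ ≤ 1 + z.im := by
    have := Complex.norm_le_abs_re_add_abs_im z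
    rw [abs_of_nonneg hre0, abs_of_nonneg him] at this
    linarith
  have hone : 1 ≤ Real.exp (c * z.im) := Real.one_le_exp (by positivity)
  have him_le : z.im ≤ 1 / c * Real.exp (c * z.im) := by
    rw [one_div_mul_eq_div, le_div_iff₀ hc, mul_comm]
    linarith [Real.add_one_le_exp (c * z.im)]
  linarith

theorem norm_sub_interpolant_le {f : ℂ → ℂ} {a C c : ℝ} (hc : 0 < c)
    (hC : ∀ z ∈ halfStrip a, ‖f z‖ ≤ C * Real.exp (c * z.im)) (u v : ℂ) {z : ℂ}
    (hz : z ∈ halfStrip 0) :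
    ‖f (a + z) - u - v * z‖ ≤ (C + ‖u‖ + ‖v‖ * (1 + 1 / c)) * Real.exp (c * z.im) := by
  obtain ⟨⟨hre0, hre1⟩, him⟩ := mem_halfStrip.1 hz
  have hf : ‖f (a + z)‖ ≤ C * Real.exp (c * z.im) := by
    simpa using hC (a + z) (mem_halfStrip.2 (by simpa using ⟨⟨hre0, by linarith⟩, him⟩))
  have hone : 1 ≤ Real.exp (c * z.im) := Real.one_le_exp (by positivity)
  calc ‖f (a + z) - u - v * z‖ ≤ ‖f (a + z)‖ + ‖u‖ + ‖v‖ * ‖z‖ := by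
        rw [← norm_mul]
        exact (norm_sub_le _ _).trans (by gcongr; exact norm_sub_le _ _)
    _ ≤ C * Real.exp (c * z.im) + ‖u‖ * Real.exp (c * z.im)
          + ‖v‖ * ((1 + 1 / c) * Real.exp (c * z.im)) := by
        gcongr
        · exact le_mul_of_one_le_right (norm_nonneg u) hone
        · exact norm_le_mul_exp_im_of_mem_halfStrip hz hc
    _ = (C + ‖u‖ + ‖v‖ * (1 + 1 / c)) * Real.exp (c * z.im) := by ring

theorem integral_sub_interpolant_re {f : ℂ → ℂ} {a : ℝ}
    (hf : ContinuousOn f (halfStrip a)) (u v : ℂ) :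
    ∫ x in (0 : ℝ)..1, (f (a + x) - u - v * x).re
      = (∫ x in a..a + 1, (f x).re) - (u.re + v.re / 2) := by
  have hint : IntervalIntegrable (fun x : ℝ => (f ((a + x : ℝ) : ℂ)).re) volume 0 1 := by
    refine ContinuousOn.intervalIntegrable
      (Complex.continuous_re.comp_continuousOn (hf.comp (by fun_prop) fun x hx => ?_))
    rw [uIcc_of_le zero_le_one] at hx
    exact ofReal_mem_halfStrip ⟨by linarith [hx.1], by linarith [hx.2]⟩
  have hshift := intervalIntegral.integral_comp_add_left (a := 0) (b := 1)
    (fun x : ℝ => (f x).re) a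
  rw [add_zero] at hshift
  simp only [Complex.sub_re, Complex.re_mul_ofReal, ← Complex.ofReal_add]
  rw [intervalIntegral.integral_sub (hint.sub (by simp))
      (Continuous.intervalIntegrable (by fun_prop) _ _),
    intervalIntegral.integral_sub hint (by simp), hshift, intervalIntegral.integral_const_mul,
    integral_id, intervalIntegral.integral_const]
  simp only [sub_zero, one_smul]
  ring

theorem integrableOn_mul_abelWeight : IntegrableOn (fun s => s * abelWeight s) (Ioi 0) := by
  have hint := integrableOn_im_mul_abelWeight (f := id) (a := 0) (C := 1) zero_le_one
    (by linarith [Real.pi_gt_three]) (fun _ _ => differentiableAt_id) (fun s hs => ?_) (by simp)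
  · simpa using hint
  · simpa [abs_of_nonneg hs] using (lt_add_one s).le.trans (Real.add_one_le_exp s)

theorem abelPlanaCorrection_sub_interpolant {f : ℂ → ℂ} {a x : ℝ} {u v : ℂ} (hu : u.im = 0)
    (hv : v.im = 0)
    (hint : IntegrableOn (fun s : ℝ => (f ((a + x : ℝ) + s * Complex.I)).im * abelWeight s)
      (Ioi 0)) :
    abelPlanaCorrection (fun z => f (a + z) - u - v * z) x
      = abelPlanaCorrection f (a + x) - v.re * ∫ s in Ioi (0 : ℝ), s * abelWeight s := by
  rw [abelPlanaCorrection, abelPlanaCorrection, ← integral_const_mul,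
    ← integral_sub hint (integrableOn_mul_abelWeight.const_mul _)]
  refine integral_congr_ae (ae_of_all _ fun s => ?_)
  simp only [Complex.sub_im, Complex.mul_im, Complex.add_re, Complex.add_im, Complex.mul_re,
    Complex.ofReal_add, Complex.ofReal_re, Complex.ofReal_im, Complex.I_re, Complex.I_im, hu, hv,
    add_assoc]
  ring

theorem abelPlanaCorrection_sub_add_one {f : ℂ → ℂ} {a C c : ℝ} (hc0 : 0 < c)
    (hc : c < 2 * Real.pi) (hd : ∀ z ∈ halfStrip a, DifferentiableAt ℂ f z)
    (hC : ∀ z ∈ halfStrip a, ‖f z‖ ≤ C * Real.exp (c * z.im))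
    (hr : ∀ x ∈ Icc a (a + 1), (f x).im = 0) :
    abelPlanaCorrection f a - abelPlanaCorrection f (a + 1)
      = (∫ x in a..a + 1, (f x).re) - ((f a).re + (f (a + 1 : ℝ)).re) / 2 := by
  set u : ℂ := f a
  set v : ℂ := f (a + 1 : ℝ) - f a with hv
  have hleft : a ∈ Icc a (a + 1) := by simp
  have hright : a + 1 ∈ Icc a (a + 1) := by simp
  have hu_im : u.im = 0 := hr a hleft
  have hv_im : v.im = 0 := by rw [hv, Complex.sub_im, hr _ hleft, hr _ hright, sub_zero]
  have hmem : ∀ z ∈ halfStrip 0, (a + z : ℂ) ∈ halfStrip a := fun z hz => by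
    simpa [mem_halfStrip] using hz
  -- Subtracting the linear interpolant makes `f` vanish at the two corners of the half-strip.
  have key := abelPlanaCorrection_zero_sub_one (h := fun z => f (a + z) - u - v * z) hc
    (fun z hz => (((hd _ (hmem z hz)).comp (f := fun z => (a : ℂ) + z) z
      (by fun_prop)).sub_const _).sub (by fun_prop))
    (fun z hz => norm_sub_interpolant_le hc0 hC u v hz)
    (fun x hx => by
      have := hr (a + x) ⟨by linarith [hx.1], by linarith [hx.2]⟩
      simpa [hu_im, hv_im] using this)
    (by simp [u]) (by simp [hv, u])
  rw [integral_sub_interpolant_re fun z hz => (hd z hz).continuousAt.continuousWithinAt] at key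
  have hint : ∀ x ∈ Icc a (a + 1),
      IntegrableOn (fun s : ℝ => (f (x + s * Complex.I)).im * abelWeight s) (Ioi 0) := fun x hx =>
    integrableOn_im_mul_abelWeight hc0.le hc (fun s hs => hd _ (add_mul_I_mem_halfStrip hx hs))
      (fun s hs => by simpa using hC _ (add_mul_I_mem_halfStrip hx hs)) (hr x hx)
  have hsub0 := abelPlanaCorrection_sub_interpolant (x := 0) hu_im hv_im
    (by simpa using hint a hleft)
  have hsub1 := abelPlanaCorrection_sub_interpolant (x := 1) hu_im hv_im
    (by simpa using hint (a + 1) hright)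
  rw [add_zero] at hsub0
  rw [hsub0, hsub1, hv, Complex.sub_re] at key
  linarith

theorem exists_norm_eval_le_exp_im (p : Polynomial ℂ) (a : ℝ) :
    ∃ C : ℝ, ∀ z ∈ halfStrip a, ‖p.eval z‖ ≤ C * Real.exp z.im := by
  induction p using Polynomial.induction_on' with
  | add p q hp hq =>
    obtain ⟨C, hC⟩ := hp
    obtain ⟨D, hD⟩ := hq
    refine ⟨C + D, fun z hz => ?_⟩
    rw [Polynomial.eval_add, add_mul]
    exact (norm_add_le _ _).trans (add_le_add (hC z hz) (hD z hz))
  | monomial n b =>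
    refine ⟨‖b‖ * (n.factorial * Real.exp (|a| + 1)), fun z hz => ?_⟩
    obtain ⟨⟨hre0, hre1⟩, him⟩ := mem_halfStrip.1 hz
    have hnorm : ‖z‖ ≤ |a| + 1 + z.im := by
      have hre : |z.re| ≤ |a| + 1 := abs_le.2
        ⟨by linarith [neg_abs_le a], by linarith [le_abs_self a]⟩
      have := Complex.norm_le_abs_re_add_abs_im z
      rw [abs_of_nonneg him] at this
      linarith
    have hpow := Real.pow_div_factorial_le_exp (|a| + 1 + z.im) (by positivity) n
    rw [div_le_iff₀' (by positivity), Real.exp_add] at hpow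
    rw [Polynomial.eval_monomial, norm_mul, norm_pow, mul_assoc, mul_assoc]
    gcongr
    exact (pow_le_pow_left₀ (norm_nonneg z) hnorm n).trans hpow

theorem integrableOn_im_eval_mul_abelWeight {p : Polynomial ℂ} {a : ℝ}
    (hr : (p.eval (a : ℂ)).im = 0) :
    IntegrableOn (fun s : ℝ => (p.eval (a + s * Complex.I)).im * abelWeight s) (Ioi 0) := by
  obtain ⟨C, hC⟩ := exists_norm_eval_le_exp_im p a
  exact integrableOn_im_mul_abelWeight (f := fun z => p.eval z) zero_le_one
    (by linarith [Real.pi_gt_three]) (fun _ _ => p.differentiableAt)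
    (fun s hs => by simpa using hC _ (add_mul_I_mem_halfStrip (by simp) hs)) hr

theorem integrableOn_im_pow_mul_abelWeight (l : ℕ) :
    IntegrableOn (fun s : ℝ => ((s * Complex.I) ^ l).im * abelWeight s) (Ioi 0) := by
  have him : ((0 : ℂ) ^ l).im = 0 := by cases l <;> simp
  simpa using integrableOn_im_eval_mul_abelWeight (p := Polynomial.X ^ l) (a := 0) (by simpa)

theorem eval_map_bernoulli_ofReal (n : ℕ) (x : ℝ) :
    ((Polynomial.bernoulli n).map (algebraMap ℚ ℂ)).eval (x : ℂ) = (bernoulliFun n x : ℂ) := by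
  have hmap : (Polynomial.bernoulli n).map (algebraMap ℚ ℂ)
      = ((Polynomial.bernoulli n).map (algebraMap ℚ ℝ)).map Complex.ofRealHom := by
    rw [Polynomial.map_map]
    congr 1
  rw [hmap, bernoulliFun]
  exact Polynomial.eval_map_apply Complex.ofRealHom x

theorem eval_map_bernoulli_one_add (l : ℕ) (z : ℂ) :
    ((Polynomial.bernoulli (l + 1)).map (algebraMap ℚ ℂ)).eval (1 + z)
      = ((Polynomial.bernoulli (l + 1)).map (algebraMap ℚ ℂ)).eval z + (l + 1) * z ^ l := by
  have h := congrArg (fun q : Polynomial ℚ => (q.map (algebraMap ℚ ℂ)).eval z)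
    (Polynomial.bernoulli_comp_one_add_X (l + 1))
  simpa [Polynomial.map_comp] using h

theorem abelPlanaCorrection_eval_one {p : Polynomial ℂ} {b : ℝ} {l : ℕ}
    (hp : ∀ z, p.eval (1 + z) = p.eval z + b * z ^ l) (hr : (p.eval 0).im = 0) :
    abelPlanaCorrection (fun z => p.eval z) 1
      = abelPlanaCorrection (fun z => p.eval z) 0
        + b * abelPlanaCorrection (fun z => z ^ l) 0 := by
  have hint := integrableOn_im_eval_mul_abelWeight (p := p) (a := 0) (by simpa using hr)
  simp only [Complex.ofReal_zero, zero_add] at hint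
  simp only [abelPlanaCorrection, zero_add, Complex.ofReal_zero, Complex.ofReal_one, hp,
    Complex.add_im, Complex.im_ofReal_mul, add_mul, mul_assoc]
  rw [← integral_const_mul,
    ← integral_add hint ((integrableOn_im_pow_mul_abelWeight l).const_mul b)]

/-- The identity `B_{l+1}(1 + z) - B_{l+1}(z) = (l + 1) z ^ l` reduces the moments to the
Abel–Plana formula for the Bernoulli polynomial, whose integral over `[0, 1]` vanishes. -/
theorem abelPlanaCorrection_pow {l : ℕ} (hl : l ≠ 0) :
    abelPlanaCorrection (fun z => z ^ l) 0 = (bernoulli (l + 1) : ℝ) / (l + 1) := by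
  set p : Polynomial ℂ := (Polynomial.bernoulli (l + 1)).map (algebraMap ℚ ℂ)
  have hreal : ∀ x : ℝ, p.eval (x : ℂ) = (bernoulliFun (l + 1) x : ℂ) :=
    eval_map_bernoulli_ofReal (l + 1)
  have hshift := abelPlanaCorrection_eval_one (p := p) (b := l + 1) (l := l)
    (mod_cast eval_map_bernoulli_one_add l) (by simpa using congrArg Complex.im (hreal 0))
  obtain ⟨C, hC⟩ := exists_norm_eval_le_exp_im p 0
  have hstep := abelPlanaCorrection_sub_add_one (f := fun z => p.eval z) (a := 0) (c := 1) one_pos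
    (by linarith [Real.pi_gt_three]) (fun _ _ => p.differentiableAt)
    (fun z hz => by simpa using hC z hz) (fun x _ => by rw [hreal, Complex.ofReal_im])
  simp only [hreal, Complex.ofReal_re, zero_add, bernoulliFun_eval_zero,
    integral_bernoulliFun_eq_zero (Nat.succ_ne_zero l),
    bernoulliFun_endpoints_eq_of_ne_one (show l + 1 ≠ 1 by omega)] at hstep
  rw [eq_div_iff (by positivity)]
  linarith

theorem abelPlanaCorrection_sum_mul_pow (b : ℕ → ℝ) (k : ℕ) :
    abelPlanaCorrection (fun z => ∑ l ∈ Finset.range (k + 1), (b l : ℂ) * z ^ l) 0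
      = ∑ l ∈ Finset.Icc 1 k, b l * ((bernoulli (l + 1) : ℝ) / (l + 1)) := by
  have hsum : abelPlanaCorrection (fun z => ∑ l ∈ Finset.range (k + 1), (b l : ℂ) * z ^ l) 0
      = ∑ l ∈ Finset.range (k + 1), b l * abelPlanaCorrection (fun z => z ^ l) 0 := by
    simp only [abelPlanaCorrection, Complex.ofReal_zero, zero_add, ← integral_const_mul,
      Complex.im_sum, Complex.im_ofReal_mul, Finset.sum_mul, mul_assoc]
    exact integral_finsetSum _ fun l _ => (integrableOn_im_pow_mul_abelWeight l).const_mul (b l)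
  rw [hsum, Finset.range_eq_Ico, Finset.sum_eq_sum_Ico_succ_bot k.succ_pos]
  have hzero : abelPlanaCorrection (fun z => z ^ 0) 0 = 0 := by simp [abelPlanaCorrection]
  rw [hzero, mul_zero, zero_add]
  exact Finset.sum_congr rfl fun l hl => by
    rw [abelPlanaCorrection_pow (Nat.one_le_iff_ne_zero.1 (Finset.mem_Ico.1 hl).1)]

theorem abelWeight_nonneg {s : ℝ} (hs : 0 ≤ s) : 0 ≤ abelWeight s :=
  div_nonneg zero_le_two (sub_nonneg.2 (Real.one_le_exp (by positivity)))

theorem integral_mul_abelWeight : ∫ s in Ioi (0 : ℝ), s * abelWeight s = 1 / 12 := by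
  have h : abelPlanaCorrection (fun z => z ^ 1) 0 = 1 / 12 := by
    rw [abelPlanaCorrection_pow one_ne_zero, bernoulli_two]
    norm_num
  simpa [abelPlanaCorrection] using h

theorem abs_abelPlanaCorrection_le {f f' : ℂ → ℂ} {a B : ℝ}
    (hf : ∀ s : ℝ, 0 ≤ s → HasDerivAt f (f' (a + s * Complex.I)) (a + s * Complex.I))
    (hB : ∀ s : ℝ, 0 ≤ s → ‖f' (a + s * Complex.I)‖ ≤ B) (hr : (f a).im = 0) :
    |abelPlanaCorrection f a| ≤ B / 12 := by
  have him : ∀ s : ℝ, 0 ≤ s → |(f (a + s * Complex.I)).im| ≤ B * s := by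
    intro s hs
    have hderiv : ∀ t ∈ Icc 0 s, HasDerivWithinAt (fun t : ℝ => f (a + t * Complex.I))
        (f' (a + t * Complex.I) * Complex.I) (Icc 0 s) t := fun t ht => by
      have hline : HasDerivAt (fun t : ℝ => (a : ℂ) + t * Complex.I) Complex.I t := by
        simpa using ((hasDerivAt_mul_const Complex.I (x := (t : ℂ))).const_add (a : ℂ)).comp_ofReal
      exact ((hf t ht.1).comp t hline).hasDerivWithinAt
    have hmvt := norm_image_sub_le_of_norm_deriv_le_segment' hderiv
      (fun t ht => by simpa using hB t ht.1) s ⟨hs, le_rfl⟩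
    refine le_trans ?_ (hmvt.trans_eq (by rw [sub_zero]))
    simpa [hr] using Complex.abs_im_le_norm (f (a + s * Complex.I) - f (a + (0 : ℝ) * Complex.I))
  calc |abelPlanaCorrection f a| ≤ ∫ s in Ioi (0 : ℝ), B * (s * abelWeight s) := by
        rw [← Real.norm_eq_abs, abelPlanaCorrection]
        refine norm_integral_le_of_norm_le (integrableOn_mul_abelWeight.const_mul B) ?_
        filter_upwards [ae_restrict_mem measurableSet_Ioi] with s hs
        have hw := abelWeight_nonneg (le_of_lt hs)
        rw [Real.norm_eq_abs, abs_mul, abs_of_nonneg hw, ← mul_assoc]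
        exact mul_le_mul_of_nonneg_right (him s (le_of_lt hs)) hw
    _ = B / 12 := by rw [integral_const_mul, integral_mul_abelWeight]; ring

theorem log_div_ofReal {x : ℝ} (hx : 0 ≤ x) :
    Complex.log x / x = ((Real.log x / x : ℝ) : ℂ) := by
  rw [← Complex.ofReal_log hx, ← Complex.ofReal_div]

theorem norm_log_le_mul_norm {z : ℂ} (hz : 1 ≤ ‖z‖) : ‖Complex.log z‖ ≤ (1 + Real.pi) * ‖z‖ := by
  calc ‖Complex.log z‖ ≤ Real.log ‖z‖ + Real.pi := by
        refine (Complex.norm_le_abs_re_add_abs_im _).trans (add_le_add ?_ ?_)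
        · rw [Complex.log_re, abs_of_nonneg (Real.log_nonneg hz)]
        · rw [Complex.log_im]
          exact Complex.abs_arg_le_pi z
    _ ≤ ‖z‖ + Real.pi * ‖z‖ :=
        add_le_add (Real.log_le_self (norm_nonneg z)) (le_mul_of_one_le_right Real.pi_nonneg hz)
    _ = (1 + Real.pi) * ‖z‖ := by ring

theorem hasDerivAt_log_div {z : ℂ} (hz : z ∈ Complex.slitPlane) :
    HasDerivAt (fun w => Complex.log w / w) ((1 - Complex.log z) / z ^ 2) z := by
  have hz0 := Complex.slitPlane_ne_zero hz
  have h := (Complex.hasDerivAt_log hz).div (hasDerivAt_id z) hz0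
  rwa [id, inv_mul_cancel₀ hz0, mul_one] at h

theorem norm_one_sub_log_div_sq_le {z : ℂ} {a : ℝ} (ha : 1 ≤ a) (hz : a ≤ z.re) :
    ‖(1 - Complex.log z) / z ^ 2‖ ≤ (2 + Real.pi) / a := by
  have haz : a ≤ ‖z‖ := hz.trans (Complex.re_le_norm z)
  have hz1 : 1 ≤ ‖z‖ := ha.trans haz
  have hnum : ‖1 - Complex.log z‖ ≤ (2 + Real.pi) * ‖z‖ := by
    have := norm_sub_le (1 : ℂ) (Complex.log z)
    rw [norm_one] at this
    linarith [norm_log_le_mul_norm hz1]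
  have ha0 : 0 < a := zero_lt_one.trans_le ha
  calc ‖(1 - Complex.log z) / z ^ 2‖ ≤ (2 + Real.pi) * ‖z‖ / ‖z‖ ^ 2 := by
        rw [norm_div, norm_pow]
        gcongr
    _ = (2 + Real.pi) / ‖z‖ := by field_simp
    _ ≤ (2 + Real.pi) / a := div_le_div_of_nonneg_left (by positivity) ha0 haz

theorem tendsto_abelPlanaCorrection_log_div :
    Tendsto (abelPlanaCorrection fun z => Complex.log z / z) atTop (𝓝 0) := by
  have hbound : Tendsto (fun a : ℝ => (2 + Real.pi) / a / 12) atTop (𝓝 0) := by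
    simpa using (tendsto_id.const_div_atTop (2 + Real.pi)).div_const 12
  refine squeeze_zero_norm' ?_ hbound
  filter_upwards [eventually_ge_atTop 1] with a ha
  exact abs_abelPlanaCorrection_le (f' := fun z => (1 - Complex.log z) / z ^ 2)
    (fun s _ => hasDerivAt_log_div (Or.inl (by simpa using zero_lt_one.trans_le ha)))
    (fun s _ => norm_one_sub_log_div_sq_le ha (by simp))
    (by rw [log_div_ofReal (zero_le_one.trans ha), Complex.ofReal_im])

theorem abelPlanaCorrection_log_div_sub_add_one {a : ℝ} (ha : 1 ≤ a) :
    abelPlanaCorrection (fun z => Complex.log z / z) a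
        - abelPlanaCorrection (fun z => Complex.log z / z) (a + 1)
      = Real.log (a + 1) ^ 2 / 2 - Real.log a ^ 2 / 2
        - (Real.log a / a + Real.log (a + 1) / (a + 1)) / 2 := by
  have hre : ∀ x : ℝ, a ≤ x → (Complex.log x / x).re = Real.log x / x := fun x hx => by
    rw [log_div_ofReal (by linarith), Complex.ofReal_re]
  have hslit : ∀ z ∈ halfStrip a, z ∈ Complex.slitPlane := fun z hz =>
    Or.inl (zero_lt_one.trans_le (ha.trans (mem_halfStrip.1 hz).1.1))
  have hbound : ∀ z ∈ halfStrip a, ‖Complex.log z / z‖ ≤ (1 + Real.pi) * Real.exp (1 * z.im) := by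
    intro z hz
    obtain ⟨⟨hre0, -⟩, him⟩ := mem_halfStrip.1 hz
    have hz1 : 1 ≤ ‖z‖ := ha.trans (hre0.trans (Complex.re_le_norm z))
    rw [norm_div, div_le_iff₀ (zero_lt_one.trans_le hz1), one_mul]
    refine (norm_log_le_mul_norm hz1).trans ?_
    gcongr
    exact le_mul_of_one_le_right (by positivity) (Real.one_le_exp him)
  have hint : ∫ x in a..a + 1, (Complex.log x / x).re = ∫ x in a..a + 1, Real.log x / x :=
    intervalIntegral.integral_congr fun x hx => by
      rw [uIcc_of_le (by linarith)] at hx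
      exact hre x hx.1
  rw [abelPlanaCorrection_sub_add_one one_pos (by linarith [Real.pi_gt_three])
    (fun z hz => (hasDerivAt_log_div (hslit z hz)).differentiableAt) hbound
    (fun x hx => by rw [log_div_ofReal (by linarith [hx.1]), Complex.ofReal_im]), hint,
    integral_log_div (by linarith) (by linarith), hre a le_rfl, hre (a + 1) (by linarith)]

theorem stieltjesOneSeq_eq {n : ℕ} (hn : 1 ≤ n) :
    stieltjesOneSeq n = Real.log n / (2 * n) + stieltjesOne
      + abelPlanaCorrection (fun z => Complex.log z / z) n := by
  set D : ℕ → ℝ := fun m => stieltjesOneSeq m - Real.log m / m / 2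
    - abelPlanaCorrection (fun z => Complex.log z / z) m with hD
  have hstep : ∀ m, 1 ≤ m → D (m + 1) = D m := fun m hm => by
    have h := abelPlanaCorrection_log_div_sub_add_one (a := m) (by exact_mod_cast hm)
    simp only [hD, stieltjesOneSeq, Finset.sum_Icc_succ_top (Nat.le_add_left 1 m), Nat.cast_add,
      Nat.cast_one]
    linarith
  have hconst : ∀ m, n ≤ m → D m = D n :=
    Nat.le_induction rfl fun m hm ih => (hstep m (hn.trans hm)).trans ih
  have hlim : Tendsto D atTop (𝓝 stieltjesOne) := by
    have hlog : Tendsto (fun m : ℕ => Real.log m / m) atTop (𝓝 0) :=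
      Real.isLittleO_log_id_atTop.tendsto_div_nhds_zero.comp tendsto_natCast_atTop_atTop
    simpa using (tendsto_stieltjesOneSeq.sub (hlog.div_const 2)).sub
      (tendsto_abelPlanaCorrection_log_div.comp tendsto_natCast_atTop_atTop)
  have hDn : D n = stieltjesOne := tendsto_nhds_unique
    (tendsto_const_nhds.congr' ((eventually_ge_atTop n).mono fun m hm => (hconst m hm).symm)) hlim
  have hcomm : Real.log n / n / 2 = Real.log n / (2 * n) := by rw [div_div, mul_comm]
  simp only [hD] at hDn
  linarith

theorem stirlingFirst_succ_two (l : ℕ) :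
    (Nat.stirlingFirst (l + 1) 2 : ℚ) = l.factorial * harmonic l := by
  induction l with
  | zero => simp [Nat.stirlingFirst]
  | succ l ih =>
    rw [Nat.stirlingFirst_succ_succ, Nat.cast_add, Nat.cast_mul, ih, Nat.stirlingFirst_one_right,
      harmonic_succ, Nat.factorial_succ]
    push_cast
    field_simp

/-- The rising factorial `(x)_k = x (x + 1) ⋯ (x + k - 1)` with the coefficient of `x ^ l`
multiplied by the harmonic number `H_l`. These polynomials are the numerators in the factorial
series of `(log a - log (a - x)) / (a - x)`. -/
noncomputable def harmonicPochhammer (k : ℕ) (x : ℂ) : ℂ :=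
  ∑ l ∈ Finset.range (k + 1), (harmonic l : ℂ) * (Nat.stirlingFirst k l : ℂ) * x ^ l

theorem harmonicPochhammer_zero (x : ℂ) : harmonicPochhammer 0 x = 0 := by
  simp [harmonicPochhammer]

theorem harmonicPochhammer_one (x : ℂ) : harmonicPochhammer 1 x = x := by
  simp [harmonicPochhammer, Finset.sum_range_succ, Nat.stirlingFirst_self]

theorem continuous_harmonicPochhammer (k : ℕ) : Continuous (harmonicPochhammer k) := by
  unfold harmonicPochhammer
  fun_prop

theorem continuous_ascPochhammer_eval_mul (k : ℕ) (x : ℂ) :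
    Continuous fun t : ℝ => (ascPochhammer ℂ k).eval (t * x) :=
  (ascPochhammer ℂ k).continuous.comp (by fun_prop)

theorem mul_integral_ascPochhammer (k : ℕ) (x : ℂ) :
    x * ∫ t in (0 : ℝ)..1, (ascPochhammer ℂ k).eval (t * x)
      = ∑ l ∈ Finset.range (k + 1), (Nat.stirlingFirst k l : ℂ) * (x ^ (l + 1) / (l + 1)) := by
  simp only [pochhammer_eq_sum_stirlingFirst, mul_pow, ← Complex.ofReal_pow]
  rw [intervalIntegral.integral_finsetSum
    (fun l _ => Continuous.intervalIntegrable (by fun_prop) _ _), Finset.mul_sum]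
  refine Finset.sum_congr rfl fun l _ => ?_
  rw [intervalIntegral.integral_const_mul, intervalIntegral.integral_mul_const,
    intervalIntegral.integral_ofReal, integral_pow, one_pow, zero_pow (Nat.succ_ne_zero l)]
  push_cast
  ring

theorem sum_harmonic_succ_mul_stirlingFirst (k : ℕ) (x : ℂ) :
    ∑ l ∈ Finset.range (k + 1),
        (harmonic (l + 1) : ℂ) * (Nat.stirlingFirst k (l + 1) : ℂ) * x ^ (l + 1)
      = harmonicPochhammer k x := by
  have h := Finset.sum_range_succ'
    (fun l => (harmonic l : ℂ) * (Nat.stirlingFirst k l : ℂ) * x ^ l) (k + 1)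
  rw [Finset.sum_range_succ, Nat.stirlingFirst_eq_zero_of_lt (Nat.lt_succ_self k)] at h
  simpa [harmonicPochhammer] using h.symm

theorem harmonicPochhammer_succ (k : ℕ) (x : ℂ) :
    harmonicPochhammer (k + 1) x
      = (x + k) * harmonicPochhammer k x
        + x * ∫ t in (0 : ℝ)..1, (ascPochhammer ℂ k).eval (t * x) := by
  rw [mul_integral_ascPochhammer, harmonicPochhammer, Finset.sum_range_succ', add_mul,
    ← sum_harmonic_succ_mul_stirlingFirst k, add_comm (x * _)]
  nth_rewrite 2 [sum_harmonic_succ_mul_stirlingFirst]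
  rw [harmonicPochhammer, Finset.mul_sum, Finset.mul_sum, ← Finset.sum_add_distrib,
    ← Finset.sum_add_distrib]
  simp only [harmonic_zero, Rat.cast_zero, zero_mul, add_zero]
  refine Finset.sum_congr rfl fun l _ => ?_
  rw [Nat.stirlingFirst_succ_succ, harmonic_succ]
  push_cast
  field_simp
  ring

theorem le_norm_add_natCast {x : ℂ} (hx : 0 ≤ x.re) (i : ℕ) : (i : ℝ) ≤ ‖x + i‖ :=
  le_trans (by simpa using hx) (Complex.re_le_norm (x + i))

theorem norm_mul_add_natCast_le {x : ℂ} (hx : 0 ≤ x.re) {t : ℝ} (ht : t ∈ Icc 0 1) (i : ℕ) :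
    ‖t * x + i‖ ≤ ‖x + i‖ := by
  have ht' : 0 ≤ 1 - t := sub_nonneg.2 ht.2
  calc ‖t * x + i‖ = ‖t * (x + i) + (1 - t : ℝ) * (i : ℂ)‖ := by push_cast; ring_nf
    _ ≤ t * ‖x + i‖ + (1 - t) * i := by
      refine (norm_add_le _ _).trans_eq ?_
      rw [norm_mul, norm_mul, Complex.norm_of_nonneg ht.1, Complex.norm_of_nonneg ht',
        Complex.norm_natCast]
    _ ≤ t * ‖x + i‖ + (1 - t) * ‖x + i‖ := by gcongr; exact le_norm_add_natCast hx i
    _ = ‖x + i‖ := by ring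

theorem norm_ascPochhammer_eval_mul_le {x : ℂ} (hx : 0 ≤ x.re) {t : ℝ} (ht : t ∈ Icc 0 1)
    (k : ℕ) : ‖(ascPochhammer ℂ k).eval (t * x)‖ ≤ ‖(ascPochhammer ℂ k).eval x‖ := by
  induction k with
  | zero => simp
  | succ k ih =>
    rw [ascPochhammer_succ_eval, ascPochhammer_succ_eval, norm_mul, norm_mul]
    exact mul_le_mul ih (norm_mul_add_natCast_le hx ht k) (norm_nonneg _) (norm_nonneg _)

theorem norm_harmonicPochhammer_succ_le {x : ℂ} (hx : 0 ≤ x.re) (j : ℕ) :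
    ‖harmonicPochhammer (j + 1) x‖
      ≤ ‖(ascPochhammer ℂ (j + 1)).eval x‖ * (1 + ‖x‖ * (harmonic j : ℝ)) := by
  induction j with
  | zero => simp [harmonicPochhammer_one]
  | succ j ih =>
    set P := ‖(ascPochhammer ℂ (j + 1)).eval x‖
    set N := ‖x + (j + 1 : ℕ)‖
    have hN : (j + 1 : ℝ) ≤ N := by simpa [N] using le_norm_add_natCast hx (j + 1)
    have hint : ‖∫ t in (0 : ℝ)..1, (ascPochhammer ℂ (j + 1)).eval (t * x)‖ ≤ P := by
      simpa using intervalIntegral.norm_integral_le_of_norm_le_const (a := 0) (b := 1)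
        fun t ht => norm_ascPochhammer_eval_mul_le hx
          (Ioc_subset_Icc_self (uIoc_of_le (zero_le_one' ℝ) ▸ ht)) (j + 1)
    have hP : P ≤ P * N * (j + 1 : ℝ)⁻¹ := by
      rw [mul_assoc]
      refine le_mul_of_one_le_right (norm_nonneg _) ?_
      rwa [← div_eq_mul_inv, one_le_div (by positivity)]
    rw [harmonicPochhammer_succ, ascPochhammer_succ_eval, norm_mul, harmonic_succ]
    calc ‖(x + (j + 1 : ℕ)) * harmonicPochhammer (j + 1) x
          + x * ∫ t in (0 : ℝ)..1, (ascPochhammer ℂ (j + 1)).eval (t * x)‖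
        ≤ N * ‖harmonicPochhammer (j + 1) x‖
          + ‖x‖ * ‖∫ t in (0 : ℝ)..1, (ascPochhammer ℂ (j + 1)).eval (t * x)‖ := by
          rw [← norm_mul, ← norm_mul]
          exact norm_add_le _ _
      _ ≤ N * (P * (1 + ‖x‖ * (harmonic j : ℝ))) + ‖x‖ * (P * N * (j + 1 : ℝ)⁻¹) := by
          gcongr
          exact hint.trans hP
      _ = P * N * (1 + ‖x‖ * ((harmonic j + ((j + 1 : ℕ) : ℚ)⁻¹ : ℚ) : ℝ)) := by
          push_cast
          ring

theorem harmonic_le_two_mul_sqrt (j : ℕ) : (harmonic j : ℝ) ≤ 2 * √((j : ℝ) + 1) := by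
  have hsqrt := Real.log_le_sub_one_of_pos (Real.sqrt_pos.2 j.cast_add_one_pos)
  rw [Real.log_sqrt j.cast_add_one_pos.le] at hsqrt
  have hlog : Real.log j ≤ Real.log ((j : ℝ) + 1) := by
    obtain rfl | hj := j.eq_zero_or_pos
    · simp
    · exact Real.log_le_log (by exact_mod_cast hj) (by linarith)
  linarith [harmonic_le_one_add_log j]

theorem tendsto_euler_sinh_prod (s : ℝ) :
    Tendsto (fun m : ℕ => Real.pi * s * ∏ i ∈ Finset.range m, (1 + s ^ 2 / ((i : ℝ) + 1) ^ 2))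
      atTop (𝓝 (Real.sinh (Real.pi * s))) := by
  have hsin : (Complex.sin (Real.pi * (s * Complex.I))).im = Real.sinh (Real.pi * s) := by
    rw [← mul_assoc, Complex.sin_mul_I, ← Complex.ofReal_mul, ← Complex.ofReal_sinh,
      Complex.im_ofReal_mul, Complex.I_im, mul_one]
  have heuler := (Complex.continuous_im.tendsto _).comp
    (Complex.tendsto_euler_sin_prod (s * Complex.I))
  rw [hsin] at heuler
  refine heuler.congr fun m => ?_
  have hfactor : ∀ i : ℕ, (1 : ℂ) - (s * Complex.I) ^ 2 / ((i : ℂ) + 1) ^ 2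
      = ((1 + s ^ 2 / ((i : ℝ) + 1) ^ 2 : ℝ) : ℂ) := fun i => by
    rw [mul_pow, Complex.I_sq]
    push_cast
    ring
  simp only [Function.comp_apply, hfactor]
  rw [← Complex.ofReal_prod, ← mul_assoc, mul_right_comm, ← Complex.ofReal_mul,
    ← Complex.ofReal_mul, Complex.im_ofReal_mul, Complex.I_im, mul_one]

theorem sinh_le_mul_exp (x : ℝ) : Real.sinh x ≤ x * Real.exp x := by
  have hexp : Real.exp (-x) = Real.exp x * Real.exp (-(2 * x)) := by
    rw [← Real.exp_add]
    ring_nf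
  rw [Real.sinh_eq, hexp]
  nlinarith [Real.exp_pos x, Real.add_one_le_exp (-(2 * x))]

theorem prod_one_add_sq_div_sq_le {s : ℝ} (hs : 0 < s) (m : ℕ) :
    ∏ i ∈ Finset.range m, (1 + s ^ 2 / ((i : ℝ) + 1) ^ 2) ≤ Real.exp (Real.pi * s) := by
  have hpi : 0 < Real.pi * s := by positivity
  have hmono : Monotone fun m : ℕ => Real.pi * s *
      ∏ i ∈ Finset.range m, (1 + s ^ 2 / ((i : ℝ) + 1) ^ 2) := by
    refine monotone_nat_of_le_succ fun m => ?_
    rw [Finset.prod_range_succ]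
    refine mul_le_mul_of_nonneg_left (le_mul_of_one_le_right (by positivity) ?_) hpi.le
    exact le_add_of_nonneg_right (by positivity)
  have hsinh := hmono.ge_of_tendsto (tendsto_euler_sinh_prod s) m
  exact le_of_mul_le_mul_left (hsinh.trans (sinh_le_mul_exp _)) hpi

theorem norm_neg_mul_I_add_natCast_sq (s : ℝ) (m : ℕ) :
    ‖-(s * Complex.I) + m‖ ^ 2 = m ^ 2 + s ^ 2 := by
  rw [← Complex.normSq_eq_norm_sq, neg_add_eq_sub, sub_eq_add_neg, ← neg_mul,
    ← Complex.ofReal_neg]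
  simpa using Complex.normSq_add_mul_I (m : ℝ) (-s)

theorem norm_ascPochhammer_succ_neg_mul_I_sq (j : ℕ) (s : ℝ) :
    ‖(ascPochhammer ℂ (j + 1)).eval (-(s * Complex.I))‖ ^ 2
      = (j.factorial * s) ^ 2 * ∏ i ∈ Finset.range j, (1 + s ^ 2 / ((i : ℝ) + 1) ^ 2) := by
  induction j with
  | zero => simp
  | succ j ih =>
    rw [ascPochhammer_succ_eval, norm_mul, mul_pow, ih, norm_neg_mul_I_add_natCast_sq,
      Finset.prod_range_succ, Nat.factorial_succ]
    push_cast
    field_simp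

theorem norm_ascPochhammer_succ_neg_mul_I_le (j : ℕ) {s : ℝ} (hs : 0 < s) :
    ‖(ascPochhammer ℂ (j + 1)).eval (-(s * Complex.I))‖
      ≤ j.factorial * s * Real.exp (Real.pi * s / 2) := by
  have hexp : Real.exp (Real.pi * s / 2) ^ 2 = Real.exp (Real.pi * s) := by
    rw [← Real.exp_nat_mul]
    push_cast
    ring_nf
  refine le_of_sq_le_sq ?_ (by positivity)
  rw [norm_ascPochhammer_succ_neg_mul_I_sq, mul_pow _ (Real.exp _), hexp]
  gcongr
  exact prod_one_add_sq_div_sq_le hs j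

/-- A common bound, up to the factor `j ! * √(j + 1)`, for the moduli at `x = -is` of the rising
factorial `(x)_{j+1}` and of its variant with harmonic coefficients. -/
noncomputable def numeratorBound (s : ℝ) : ℝ := 2 * s * (1 + s) * Real.exp (Real.pi * s / 2)

theorem norm_ascPochhammer_succ_le_numeratorBound (j : ℕ) {s : ℝ} (hs : 0 < s) :
    ‖(ascPochhammer ℂ (j + 1)).eval (-(s * Complex.I))‖
      ≤ j.factorial * √((j : ℝ) + 1) * numeratorBound s := by
  have hsqrt : 1 ≤ √((j : ℝ) + 1) := Real.one_le_sqrt.2 (by simp)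
  calc ‖(ascPochhammer ℂ (j + 1)).eval (-(s * Complex.I))‖
      ≤ j.factorial * 1 * (1 * s * 1 * Real.exp (Real.pi * s / 2)) := by
        simpa [mul_assoc] using norm_ascPochhammer_succ_neg_mul_I_le j hs
    _ ≤ j.factorial * √((j : ℝ) + 1) * (2 * s * (1 + s) * Real.exp (Real.pi * s / 2)) := by
        gcongr <;> linarith

theorem norm_harmonicPochhammer_succ_le_numeratorBound (j : ℕ) {s : ℝ} (hs : 0 < s) :
    ‖harmonicPochhammer (j + 1) (-(s * Complex.I))‖
      ≤ j.factorial * √((j : ℝ) + 1) * numeratorBound s := by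
  have hsqrt : 1 ≤ √((j : ℝ) + 1) := Real.one_le_sqrt.2 (by simp)
  have hnorm : ‖-(s * Complex.I)‖ = s := by simp [abs_of_pos hs]
  have hharm : 1 + s * (harmonic j : ℝ) ≤ √((j : ℝ) + 1) * (2 * (1 + s)) := by
    nlinarith [mul_le_mul_of_nonneg_left (harmonic_le_two_mul_sqrt j) hs.le]
  calc ‖harmonicPochhammer (j + 1) (-(s * Complex.I))‖
      ≤ ‖(ascPochhammer ℂ (j + 1)).eval (-(s * Complex.I))‖ * (1 + s * (harmonic j : ℝ)) := by
        simpa only [hnorm] using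
          norm_harmonicPochhammer_succ_le (x := -(s * Complex.I)) (by simp) j
    _ ≤ ‖(ascPochhammer ℂ (j + 1)).eval (-(s * Complex.I))‖
          * (√((j : ℝ) + 1) * (2 * (1 + s))) := by gcongr
    _ ≤ j.factorial * s * Real.exp (Real.pi * s / 2) * (√((j : ℝ) + 1) * (2 * (1 + s))) := by
        gcongr
        exact norm_ascPochhammer_succ_neg_mul_I_le j hs
    _ = j.factorial * √((j : ℝ) + 1) * numeratorBound s := by
        rw [numeratorBound]
        ring

theorem ascPochhammer_eval_ofReal (k : ℕ) (a : ℝ) :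
    (ascPochhammer ℂ k).eval (a : ℂ) = ((ascPochhammer ℝ k).eval a : ℝ) := by
  rw [← ascPochhammer_map Complex.ofRealHom, Polynomial.eval_map]
  exact Polynomial.eval₂_at_apply Complex.ofRealHom a

theorem ascPochhammer_eval_ne_zero {F : Type*} [Field F] {a : F} (ha : ∀ k : ℕ, a + k ≠ 0)
    (k : ℕ) : (ascPochhammer F k).eval a ≠ 0 := by
  induction k with
  | zero => simp
  | succ k ih =>
    rw [ascPochhammer_succ_eval]
    exact mul_ne_zero ih (ha k)

theorem factorial_le_ascPochhammer_eval {a : ℝ} (ha : 1 ≤ a) (k : ℕ) :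
    (k.factorial : ℝ) ≤ (ascPochhammer ℝ k).eval a := by
  induction k with
  | zero => simp
  | succ k ih =>
    rw [ascPochhammer_succ_eval, Nat.factorial_succ, mul_comm, Nat.cast_mul]
    push_cast
    exact mul_le_mul ih (by linarith) (by positivity) ((Nat.cast_nonneg _).trans ih)

theorem factorial_le_norm_ascPochhammer_eval {a : ℝ} (ha : 1 ≤ a) (k : ℕ) :
    (k.factorial : ℝ) ≤ ‖(ascPochhammer ℂ k).eval (a : ℂ)‖ := by
  rw [ascPochhammer_eval_ofReal, Complex.norm_real]
  exact (factorial_le_ascPochhammer_eval ha k).trans (Real.le_norm_self _)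

theorem norm_div_ascPochhammer_succ_le {a B : ℝ} (ha : 1 ≤ a) {c : ℂ} {j : ℕ}
    (hc : ‖c‖ ≤ j.factorial * √((j : ℝ) + 1) * B) :
    ‖c / (ascPochhammer ℂ (j + 1)).eval (a : ℂ)‖ ≤ B / √((j : ℝ) + 1) := by
  rw [norm_div]
  calc ‖c‖ / ‖(ascPochhammer ℂ (j + 1)).eval (a : ℂ)‖
      ≤ j.factorial * √((j : ℝ) + 1) * B / (j + 1).factorial :=
        div_le_div₀ ((norm_nonneg c).trans hc) hc (by positivity)
          (factorial_le_norm_ascPochhammer_eval ha (j + 1))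
    _ = √((j : ℝ) + 1) / (j + 1) * B := by
        rw [Nat.factorial_succ]
        push_cast
        field_simp
    _ = B / √((j : ℝ) + 1) := by
        rw [Real.sqrt_div_self', one_div_mul_eq_div]

theorem norm_div_ascPochhammer_add_two_le {a B : ℝ} (ha : 1 ≤ a) {c : ℂ} {j : ℕ}
    (hc : ‖c‖ ≤ j.factorial * √((j : ℝ) + 1) * B) :
    ‖c / (ascPochhammer ℂ (j + 2)).eval (a : ℂ)‖ ≤ 1 / ((j + 1 : ℕ) : ℝ) ^ (3 / 2 : ℝ) * B := by
  have hstep : ((j + 1 : ℕ) : ℝ) ≤ ‖(a : ℂ) + (j + 1 : ℕ)‖ :=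
    le_norm_add_natCast (by simpa using zero_le_one.trans ha) (j + 1)
  have hpow : ((j + 1 : ℕ) : ℝ) ^ (3 / 2 : ℝ) = √((j : ℝ) + 1) * ((j + 1 : ℕ) : ℝ) := by
    rw [Real.sqrt_eq_rpow, show (3 / 2 : ℝ) = 1 / 2 + 1 by norm_num, Real.rpow_add (by positivity),
      Real.rpow_one, Nat.cast_add_one]
  rw [ascPochhammer_succ_eval, ← div_div, norm_div, hpow]
  calc ‖c / (ascPochhammer ℂ (j + 1)).eval (a : ℂ)‖ / ‖(a : ℂ) + (j + 1 : ℕ)‖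
      ≤ B / √((j : ℝ) + 1) / ((j + 1 : ℕ) : ℝ) :=
        div_le_div₀ ((norm_nonneg _).trans (norm_div_ascPochhammer_succ_le ha hc))
          (norm_div_ascPochhammer_succ_le ha hc) (by positivity) hstep
    _ = 1 / (√((j : ℝ) + 1) * ((j + 1 : ℕ) : ℝ)) * B := by rw [div_div, one_div_mul_eq_div]

theorem summable_one_div_succ_rpow : Summable fun j : ℕ => 1 / ((j + 1 : ℕ) : ℝ) ^ (3 / 2 : ℝ) :=
  (summable_nat_add_iff 1).2 (Real.summable_one_div_nat_rpow.2 (by norm_num))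

section FactorialSeries

variable {a B : ℝ} {c : ℕ → ℂ}

theorem summable_div_ascPochhammer (ha : 1 ≤ a)
    (hc : ∀ j : ℕ, ‖c (j + 1)‖ ≤ j.factorial * √((j : ℝ) + 1) * B) :
    Summable fun k => c k / (ascPochhammer ℂ (k + 1)).eval (a : ℂ) :=
  (summable_nat_add_iff 1).1 (Summable.of_norm_bounded (summable_one_div_succ_rpow.mul_right B)
    fun j => norm_div_ascPochhammer_add_two_le ha (hc j))

theorem tendsto_div_ascPochhammer (ha : 1 ≤ a)
    (hc : ∀ j : ℕ, ‖c (j + 1)‖ ≤ j.factorial * √((j : ℝ) + 1) * B) :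
    Tendsto (fun k => c k / (ascPochhammer ℂ k).eval (a : ℂ)) atTop (𝓝 0) := by
  have hlim : Tendsto (fun j : ℕ => B / √((j : ℝ) + 1)) atTop (𝓝 0) :=
    (Real.tendsto_sqrt_atTop.comp (tendsto_atTop_add_const_right _ 1
      tendsto_natCast_atTop_atTop)).const_div_atTop B
  exact (tendsto_add_atTop_iff_nat 1).1
    (squeeze_zero_norm (fun j => norm_div_ascPochhammer_succ_le ha (hc j)) hlim)

end FactorialSeries

theorem sum_ascPochhammer_div_ascPochhammer {F : Type*} [Field F] {a x : F} (hax : a - x ≠ 0)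
    (ha : ∀ k : ℕ, a + k ≠ 0) (K : ℕ) :
    ∑ k ∈ Finset.range K, (ascPochhammer F k).eval x / (ascPochhammer F (k + 1)).eval a
      = (1 - (ascPochhammer F K).eval x / (ascPochhammer F K).eval a) / (a - x) := by
  induction K with
  | zero => simp
  | succ K ih =>
    have hP := ascPochhammer_eval_ne_zero ha K
    have haK := ha K
    rw [Finset.sum_range_succ, ih, ascPochhammer_succ_eval, ascPochhammer_succ_eval]
    field_simp
    ring

section Resolvent

variable {a : ℝ} {x : ℂ}

theorem re_sub_mul_pos (ha : 0 < a) (hx : x.re < a) {t : ℝ} (ht : t ∈ Icc 0 1) :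
    0 < ((a : ℂ) - t * x).re := by
  rw [Complex.sub_re, Complex.ofReal_re, Complex.re_ofReal_mul]
  have hxa : t * x.re ≤ t * a := mul_le_mul_of_nonneg_left hx.le ht.1
  obtain rfl | ht1 := ht.2.eq_or_lt
  · linarith
  · nlinarith

theorem sub_mul_ne_zero (ha : 0 < a) (hx : x.re < a) {t : ℝ} (ht : t ∈ Icc 0 1) :
    (a : ℂ) - t * x ≠ 0 :=
  Complex.slitPlane_ne_zero (Or.inl (re_sub_mul_pos ha hx ht))

theorem mul_integral_one_div_sub (ha : 0 < a) (hx : x.re < a) :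
    x * ∫ t in (0 : ℝ)..1, 1 / ((a : ℂ) - t * x) = Complex.log a - Complex.log (a - x) := by
  have hderiv : ∀ t ∈ uIcc (0 : ℝ) 1, HasDerivAt (fun t : ℝ => -Complex.log ((a : ℂ) - t * x))
      (x * (1 / ((a : ℂ) - t * x))) t := fun t ht => by
    rw [uIcc_of_le zero_le_one] at ht
    have hline : HasDerivAt (fun t : ℝ => (a : ℂ) - t * x) (-(1 * x)) t :=
      ((hasDerivAt_id t).ofReal_comp.mul_const x).const_sub (a : ℂ)
    refine (hline.clog_real (Or.inl (re_sub_mul_pos ha hx ht))).neg.congr_deriv ?_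
    ring
  rw [← intervalIntegral.integral_const_mul,
    intervalIntegral.integral_eq_sub_of_hasDerivAt hderiv]
  · simp [neg_add_eq_sub]
  · refine ContinuousOn.intervalIntegrable (continuousOn_const.mul
      (continuousOn_const.div (by fun_prop) fun t ht => ?_))
    exact sub_mul_ne_zero ha hx (uIcc_of_le (zero_le_one' ℝ) ▸ ht)

theorem intervalIntegrable_ascPochhammer_div (ha : 0 < a) (hx : x.re < a) (K : ℕ) :
    IntervalIntegrable (fun t : ℝ => (ascPochhammer ℂ K).eval (t * x)
      / (ascPochhammer ℂ K).eval (a : ℂ) / (a - t * x)) volume 0 1 := by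
  refine ContinuousOn.intervalIntegrable (ContinuousOn.div
    ((continuous_ascPochhammer_eval_mul K x).div_const _).continuousOn (by fun_prop)
    fun t ht => ?_)
  exact sub_mul_ne_zero ha hx (uIcc_of_le (zero_le_one' ℝ) ▸ ht)

theorem ofReal_add_natCast_ne_zero (ha : 0 < a) (k : ℕ) : (a : ℂ) + k ≠ 0 :=
  Complex.slitPlane_ne_zero (Or.inl (by simpa using by positivity))

theorem integral_ascPochhammer_succ_div (ha : 0 < a) (hx : x.re < a) (K : ℕ) :
    ∫ t in (0 : ℝ)..1, (ascPochhammer ℂ (K + 1)).eval (t * x)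
        / (ascPochhammer ℂ (K + 1)).eval (a : ℂ) / (a - t * x)
      = (∫ t in (0 : ℝ)..1, (ascPochhammer ℂ K).eval (t * x)
          / (ascPochhammer ℂ K).eval (a : ℂ) / (a - t * x))
        - (∫ t in (0 : ℝ)..1, (ascPochhammer ℂ K).eval (t * x))
          / (ascPochhammer ℂ (K + 1)).eval (a : ℂ) := by
  rw [← intervalIntegral.integral_div, ← intervalIntegral.integral_sub
    (intervalIntegrable_ascPochhammer_div ha hx K)
    ((continuous_ascPochhammer_eval_mul K x).div_const _ |>.intervalIntegrable _ _)]
  refine intervalIntegral.integral_congr fun t ht => ?_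
  have hax := sub_mul_ne_zero ha hx (uIcc_of_le (zero_le_one' ℝ) ▸ ht)
  have hP := ascPochhammer_eval_ne_zero (ofReal_add_natCast_ne_zero ha) K
  have haK := ofReal_add_natCast_ne_zero ha K
  simp only [ascPochhammer_succ_eval]
  field_simp
  ring

theorem sum_harmonicPochhammer_div_ascPochhammer (ha : 0 < a) (hx : x.re < a) (K : ℕ) :
    (a - x) * ∑ k ∈ Finset.range K,
        harmonicPochhammer k x / (ascPochhammer ℂ (k + 1)).eval (a : ℂ)
      = Complex.log a - Complex.log (a - x)
        - x * (∫ t in (0 : ℝ)..1, (ascPochhammer ℂ K).eval (t * x)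
          / (ascPochhammer ℂ K).eval (a : ℂ) / (a - t * x))
        - harmonicPochhammer K x / (ascPochhammer ℂ K).eval (a : ℂ) := by
  induction K with
  | zero =>
    simpa [harmonicPochhammer_zero] using
      (sub_eq_zero.2 (mul_integral_one_div_sub ha hx).symm).symm
  | succ K ih =>
    have hP := ascPochhammer_eval_ne_zero (ofReal_add_natCast_ne_zero ha) K
    have haK := ofReal_add_natCast_ne_zero ha K
    rw [Finset.sum_range_succ, mul_add, ih, integral_ascPochhammer_succ_div ha hx,
      harmonicPochhammer_succ, ascPochhammer_succ_eval]
    field_simp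
    ring

theorem tendsto_integral_ascPochhammer_div (hx0 : 0 ≤ x.re) (hx : x.re < a)
    (hlim : Tendsto (fun K => (ascPochhammer ℂ K).eval x / (ascPochhammer ℂ K).eval (a : ℂ))
      atTop (𝓝 0)) :
    Tendsto (fun K => ∫ t in (0 : ℝ)..1, (ascPochhammer ℂ K).eval (t * x)
      / (ascPochhammer ℂ K).eval (a : ℂ) / (a - t * x)) atTop (𝓝 0) := by
  have hbound := hlim.norm.div_const (a - x.re)
  rw [norm_zero, zero_div] at hbound
  refine squeeze_zero_norm (fun K => ?_) hbound
  refine (intervalIntegral.norm_integral_le_of_norm_le_const fun t ht => ?_).trans_eq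
    (by rw [sub_zero, abs_one, mul_one])
  have ht' : t ∈ Icc 0 1 := Ioc_subset_Icc_self (uIoc_of_le (zero_le_one' ℝ) ▸ ht)
  have hden : a - x.re ≤ ‖(a : ℂ) - t * x‖ := by
    refine le_trans ?_ (Complex.re_le_norm _)
    rw [Complex.sub_re, Complex.ofReal_re, Complex.re_ofReal_mul]
    exact sub_le_sub_left (mul_le_of_le_one_left hx0 ht'.2) a
  rw [norm_div, norm_div, norm_div]
  exact div_le_div₀ (by positivity)
    (div_le_div_of_nonneg_right (norm_ascPochhammer_eval_mul_le hx0 ht' K) (norm_nonneg _))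
    (sub_pos.2 hx) hden

end Resolvent

theorem hasSum_ascPochhammer_div_ascPochhammer {a s : ℝ} (ha : 1 ≤ a) (hs : 0 < s) :
    HasSum (fun j : ℕ => (ascPochhammer ℂ (j + 1)).eval (-(s * Complex.I))
        / (ascPochhammer ℂ (j + 2)).eval (a : ℂ))
      ((a + s * Complex.I)⁻¹ - (a : ℂ)⁻¹) := by
  have ha0 : 0 < a := zero_lt_one.trans_le ha
  have hc := fun j => norm_ascPochhammer_succ_le_numeratorBound j hs
  have hax : (a : ℂ) - -(s * Complex.I) ≠ 0 := by
    simpa using sub_mul_ne_zero (x := -(s * Complex.I)) ha0 (by simpa using ha0)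
      (right_mem_Icc.2 zero_le_one)
  have hlim := ((tendsto_div_ascPochhammer
    (c := fun k => (ascPochhammer ℂ k).eval (-(s * Complex.I))) ha hc).const_sub 1).div_const
    ((a : ℂ) - -(s * Complex.I))
  have hsum := (summable_div_ascPochhammer
    (c := fun k => (ascPochhammer ℂ k).eval (-(s * Complex.I))) ha hc).hasSum_iff_tendsto_nat.2
    (hlim.congr fun K => (sum_ascPochhammer_div_ascPochhammer hax
      (ofReal_add_natCast_ne_zero ha0) K).symm)
  simpa using (hasSum_nat_add_iff' 1).2 hsum

theorem hasSum_harmonicPochhammer_div_ascPochhammer {a s : ℝ} (ha : 1 ≤ a) (hs : 0 < s) :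
    HasSum (fun j : ℕ => harmonicPochhammer (j + 1) (-(s * Complex.I))
        / (ascPochhammer ℂ (j + 2)).eval (a : ℂ))
      ((Complex.log a - Complex.log (a + s * Complex.I)) / (a + s * Complex.I)) := by
  set x : ℂ := -(s * Complex.I) with hx
  have ha0 : 0 < a := zero_lt_one.trans_le ha
  have hre : x.re = 0 := by simp [hx]
  have hxa : x.re < a := hre.trans_lt ha0
  have hc := fun j => norm_harmonicPochhammer_succ_le_numeratorBound j hs
  have hax : (a : ℂ) - x ≠ 0 := by
    simpa using sub_mul_ne_zero ha0 hxa (right_mem_Icc.2 zero_le_one)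
  have hrest := tendsto_integral_ascPochhammer_div hre.ge hxa (tendsto_div_ascPochhammer
    (c := fun k => (ascPochhammer ℂ k).eval x) ha
    fun j => norm_ascPochhammer_succ_le_numeratorBound j hs)
  have hlim := (((hrest.const_mul x).const_sub (Complex.log a - Complex.log (a - x))).sub
    (tendsto_div_ascPochhammer (c := fun k => harmonicPochhammer k x) ha hc)).div_const (a - x)
  have hsum := (summable_div_ascPochhammer
    (c := fun k => harmonicPochhammer k x) ha hc).hasSum_iff_tendsto_nat.2
    (hlim.congr fun K => by
      rw [← sum_harmonicPochhammer_div_ascPochhammer ha0 hxa, mul_div_cancel_left₀ _ hax])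
  have hxs : (a : ℂ) - x = a + s * Complex.I := by rw [hx, sub_neg_eq_add]
  simpa [harmonicPochhammer_zero, hxs] using (hasSum_nat_add_iff' 1).2 hsum

theorem measurable_abelWeight : Measurable abelWeight := by
  unfold abelWeight
  fun_prop

theorem integrableOn_numeratorBound_mul_abelWeight :
    IntegrableOn (fun s => numeratorBound s * abelWeight s) (Ioi 0) := by
  let f : ℂ → ℂ := fun z => 2 * z * (1 - Complex.I * z)
    * Complex.exp (-(Real.pi * Complex.I / 2) * z)
  have hf : ∀ s : ℝ, f (s * Complex.I) = numeratorBound s * Complex.I := fun s => by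
    have hI : ∀ w : ℂ, w * Complex.I * Complex.I = -w := fun w => by
      rw [mul_assoc, Complex.I_mul_I, mul_neg_one]
    have hone : 1 - Complex.I * (s * Complex.I) = 1 + s := by
      rw [mul_comm, hI, sub_neg_eq_add]
    have hexp : -(Real.pi * Complex.I / 2) * (s * Complex.I) = Real.pi * s / 2 := by
      linear_combination (-(Real.pi * s / 2) : ℂ) * Complex.I_mul_I
    simp only [f, hone, hexp, numeratorBound]
    push_cast
    ring
  have hbound : ∀ s : ℝ, 0 ≤ s → ‖f (s * Complex.I)‖ ≤ 4 * Real.exp ((Real.pi / 2 + 1) * s) :=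
    fun s hs => by
      have hnn : 0 ≤ numeratorBound s := by rw [numeratorBound]; positivity
      have hpoly : 2 * s * (1 + s) ≤ 4 * Real.exp s := by
        linarith [Real.quadratic_le_exp_of_nonneg hs]
      rw [hf, norm_mul, Complex.norm_I, mul_one, Complex.norm_of_nonneg hnn, numeratorBound,
        add_mul, one_mul, Real.exp_add, mul_comm (Real.exp _), ← mul_assoc, mul_div_right_comm]
      gcongr
  have hint := integrableOn_im_mul_abelWeight (f := f) (a := 0) (C := 4) (c := Real.pi / 2 + 1)
    (by positivity) (by linarith [Real.pi_gt_three]) (fun s _ => by fun_prop)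
    (fun s hs => by simpa using hbound s hs) (by simp [f])
  simpa [hf] using hint

theorem hasSum_abelPlanaCorrection_div {a b : ℝ} (ha : 1 ≤ a) {c : ℕ → ℂ → ℂ} {g : ℂ → ℂ}
    (hcont : ∀ j, Continuous (c j))
    (hc : ∀ (j : ℕ) {s : ℝ}, 0 < s →
      ‖c j (s * Complex.I)‖ ≤ j.factorial * √((j : ℝ) + 1) * numeratorBound s)
    (hg : ∀ {s : ℝ}, 0 < s → HasSum
      (fun j => c j (s * Complex.I) / (ascPochhammer ℂ (j + 2)).eval (a : ℂ))
      (g (b + s * Complex.I))) :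
    HasSum (fun j => abelPlanaCorrection (c j) 0 / (ascPochhammer ℝ (j + 2)).eval a)
      (abelPlanaCorrection g b) := by
  have hae : ∀ {p : ℝ → Prop}, (∀ s, 0 < s → p s) →
      ∀ᵐ s ∂volume.restrict (Ioi (0 : ℝ)), p s := fun h =>
    (ae_restrict_iff' measurableSet_Ioi).2 (ae_of_all _ h)
  simp only [abelPlanaCorrection, Complex.ofReal_zero, zero_add, ← integral_div]
  refine hasSum_integral_of_dominated_convergence
    (fun j s => 1 / ((j + 1 : ℕ) : ℝ) ^ (3 / 2 : ℝ) * (numeratorBound s * abelWeight s))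
    (fun j => ?_) (fun j => hae fun s hs => ?_)
    (ae_of_all _ fun s => summable_one_div_succ_rpow.mul_right _) ?_ (hae fun s hs => ?_)
  · have hmeas : Measurable fun s : ℝ => (c j (s * Complex.I)).im :=
      (Complex.continuous_im.comp ((hcont j).comp (by fun_prop))).measurable
    exact ((hmeas.mul measurable_abelWeight).div_const _).aestronglyMeasurable
  · have hw := abelWeight_nonneg hs.le
    rw [mul_div_right_comm, norm_mul, Real.norm_of_nonneg hw, ← mul_assoc,
      ← Complex.div_ofReal_im, ← ascPochhammer_eval_ofReal]
    exact mul_le_mul_of_nonneg_right ((Complex.abs_im_le_norm _).trans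
      (norm_div_ascPochhammer_add_two_le ha (hc j hs))) hw
  · simp only [tsum_mul_right]
    exact integrableOn_numeratorBound_mul_abelWeight.const_mul _
  · refine ((Complex.hasSum_im (hg hs)).mul_right (abelWeight s)).congr_fun fun j => ?_
    rw [ascPochhammer_eval_ofReal, Complex.div_ofReal_im, mul_div_right_comm]

theorem neg_one_pow_mul_stirlingS (k l : ℕ) :
    (-1 : ℝ) ^ k * (stirlingS k l : ℝ) = (-1) ^ l * (Nat.stirlingFirst k l : ℝ) := by
  rw [stirlingS, Int.cast_mul, Int.cast_pow, Int.cast_neg, Int.cast_one, Int.cast_natCast,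
    pow_add, ← mul_assoc, ← mul_assoc, ← mul_pow, neg_one_mul, neg_neg, one_pow, one_mul]

theorem stirlingS_succ_two (l : ℕ) :
    (stirlingS (l + 1) 2 : ℝ) = (-1) ^ (l + 1) * (l.factorial * (harmonic l : ℝ)) := by
  have hfirst : (Nat.stirlingFirst (l + 1) 2 : ℝ) = l.factorial * (harmonic l : ℝ) := by
    exact_mod_cast congrArg (Rat.cast : ℚ → ℝ) (stirlingFirst_succ_two l)
  rw [stirlingS, ← hfirst]
  push_cast
  ring

theorem coeffB_eq_abelPlanaCorrection (k : ℕ) :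
    coeffB k = abelPlanaCorrection (fun z => (ascPochhammer ℂ k).eval (-z)) 0 := by
  have hexpand : (fun z : ℂ => (ascPochhammer ℂ k).eval (-z)) = fun z =>
      ∑ l ∈ Finset.range (k + 1), (((-1) ^ l * (Nat.stirlingFirst k l : ℝ) : ℝ) : ℂ) * z ^ l := by
    funext z
    rw [pochhammer_eq_sum_stirlingFirst]
    refine Finset.sum_congr rfl fun l _ => ?_
    rw [neg_pow]
    push_cast
    ring
  rw [hexpand, abelPlanaCorrection_sum_mul_pow, coeffB, Finset.mul_sum]
  refine Finset.sum_congr rfl fun l _ => ?_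
  rw [← neg_one_pow_mul_stirlingS]
  ring

theorem coeffA_eq_abelPlanaCorrection (k : ℕ) :
    coeffA k = abelPlanaCorrection (fun z => -harmonicPochhammer k (-z)) 0 := by
  have hexpand : (fun z : ℂ => -harmonicPochhammer k (-z)) = fun z =>
      ∑ l ∈ Finset.range (k + 1),
        ((-((harmonic l : ℝ) * ((-1) ^ l * (Nat.stirlingFirst k l : ℝ))) : ℝ) : ℂ) * z ^ l := by
    funext z
    rw [harmonicPochhammer, ← Finset.sum_neg_distrib]
    refine Finset.sum_congr rfl fun l _ => ?_
    rw [neg_pow]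
    push_cast
    ring
  rw [hexpand, abelPlanaCorrection_sum_mul_pow, coeffA, Finset.mul_sum]
  refine Finset.sum_congr rfl fun l _ => ?_
  have hsign : (-1 : ℝ) ^ l * (-1) ^ l = 1 := by rw [← mul_pow, neg_one_mul, neg_neg, one_pow]
  rw [← neg_one_pow_mul_stirlingS, stirlingS_succ_two, Nat.factorial_succ, pow_succ]
  push_cast
  field_simp
  linear_combination
    (-((bernoulli (l + 1) : ℝ) * (harmonic l : ℝ) * (stirlingS k l : ℝ))) * hsign

theorem hasSum_coeffA_div_ascPochhammer {a : ℝ} (ha : 1 ≤ a) :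
    HasSum (fun j : ℕ => coeffA (j + 1) / (ascPochhammer ℝ (j + 2)).eval a)
      (abelPlanaCorrection (fun z => (Complex.log z - Complex.log a) / z) a) := by
  simp only [coeffA_eq_abelPlanaCorrection]
  refine hasSum_abelPlanaCorrection_div ha
    (fun j => ((continuous_harmonicPochhammer (j + 1)).comp continuous_neg).neg)
    (fun j s hs => ?_) fun {s} hs => ?_
  · rw [norm_neg]
    exact norm_harmonicPochhammer_succ_le_numeratorBound j hs
  · simpa only [neg_div, ← neg_sub (Complex.log a)] using
      (hasSum_harmonicPochhammer_div_ascPochhammer ha hs).neg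

theorem hasSum_coeffB_div_ascPochhammer {a : ℝ} (ha : 1 ≤ a) :
    HasSum (fun j : ℕ => coeffB (j + 1) / (ascPochhammer ℝ (j + 2)).eval a)
      (abelPlanaCorrection (fun z => z⁻¹ - (a : ℂ)⁻¹) a) := by
  simp only [coeffB_eq_abelPlanaCorrection]
  exact hasSum_abelPlanaCorrection_div ha
    (fun j => (ascPochhammer ℂ (j + 1)).continuous.comp continuous_neg)
    (fun j _ hs => norm_ascPochhammer_succ_le_numeratorBound j hs)
    (hasSum_ascPochhammer_div_ascPochhammer ha)

theorem add_mul_I_mem_slitPlane {a : ℝ} (ha : 0 < a) (s : ℝ) :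
    (a : ℂ) + s * Complex.I ∈ Complex.slitPlane :=
  Or.inl (by simpa using ha)

theorem le_norm_add_mul_I (a s : ℝ) : a ≤ ‖(a : ℂ) + s * Complex.I‖ := by
  simpa using Complex.re_le_norm ((a : ℂ) + s * Complex.I)

theorem integrableOn_im_log_div_mul_abelWeight {a : ℝ} (ha : 1 ≤ a) :
    IntegrableOn (fun s : ℝ => (Complex.log (a + s * Complex.I) / (a + s * Complex.I)).im
      * abelWeight s) (Ioi 0) := by
  have ha0 : 0 < a := zero_lt_one.trans_le ha
  refine integrableOn_im_mul_abelWeight (f := fun z => Complex.log z / z) (C := 1 + Real.pi)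
    le_rfl (by positivity)
    (fun s _ => (hasDerivAt_log_div (add_mul_I_mem_slitPlane ha0 s)).differentiableAt)
    (fun s _ => ?_) (by rw [log_div_ofReal ha0.le, Complex.ofReal_im])
  have hnorm := ha.trans (le_norm_add_mul_I a s)
  rw [norm_div, div_le_iff₀ (zero_lt_one.trans_le hnorm), zero_mul, Real.exp_zero, mul_one]
  exact norm_log_le_mul_norm hnorm

theorem integrableOn_im_inv_mul_abelWeight {a : ℝ} (ha : 0 < a) :
    IntegrableOn (fun s : ℝ => ((a + s * Complex.I)⁻¹).im * abelWeight s) (Ioi 0) := by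
  refine integrableOn_im_mul_abelWeight (f := fun z => z⁻¹) (C := a⁻¹) le_rfl (by positivity)
    (fun s _ => differentiableAt_inv
      (Complex.slitPlane_ne_zero (add_mul_I_mem_slitPlane ha s))) (fun s _ => ?_)
    (by rw [← Complex.ofReal_inv, Complex.ofReal_im])
  rw [norm_inv, zero_mul, Real.exp_zero, mul_one]
  exact inv_anti₀ ha (le_norm_add_mul_I a s)

theorem abelPlanaCorrection_log_div_eq_add {a : ℝ} (ha : 1 ≤ a) :
    abelPlanaCorrection (fun z => Complex.log z / z) a
      = abelPlanaCorrection (fun z => (Complex.log z - Complex.log a) / z) a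
        + Real.log a * abelPlanaCorrection (fun z => z⁻¹ - (a : ℂ)⁻¹) a := by
  have ha0 : 0 < a := zero_lt_one.trans_le ha
  have hinv_im : ((a : ℂ)⁻¹).im = 0 := by rw [← Complex.ofReal_inv, Complex.ofReal_im]
  have hinv : abelPlanaCorrection (fun z => z⁻¹ - (a : ℂ)⁻¹) a
      = abelPlanaCorrection (fun z => z⁻¹) a := by
    simp only [abelPlanaCorrection, Complex.sub_im, hinv_im, sub_zero]
  have hlog : abelPlanaCorrection (fun z => (Complex.log z - Complex.log a) / z) a
      = abelPlanaCorrection (fun z => Complex.log z / z) a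
        - Real.log a * abelPlanaCorrection (fun z => z⁻¹) a := by
    simp only [abelPlanaCorrection]
    rw [← integral_const_mul, ← integral_sub (integrableOn_im_log_div_mul_abelWeight ha)
      ((integrableOn_im_inv_mul_abelWeight ha0).const_mul _)]
    refine integral_congr_ae (ae_of_all _ fun s => ?_)
    simp only [Complex.sub_im, ← Complex.ofReal_log ha0.le, div_eq_mul_inv,
      Complex.im_ofReal_mul, sub_mul, mul_assoc]
  rw [hinv, hlog, sub_add_cancel]

theorem risingProd_eq_ascPochhammer_eval (n k : ℕ) :
    risingProd n k = (ascPochhammer ℝ (k + 1)).eval (n : ℝ) := by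
  rw [risingProd]
  generalize k + 1 = m
  induction m with
  | zero => simp
  | succ m ih => rw [Finset.prod_range_succ, ih, ascPochhammer_succ_eval]

theorem bernoulli_three : bernoulli 3 = 0 := bernoulli_eq_zero_of_odd (by decide) (by norm_num)

theorem bernoulli_four : bernoulli 4 = -1 / 30 := by
  rw [bernoulli_eq_bernoulli'_of_ne_one (by norm_num), bernoulli'_four]

theorem bernoulli_five : bernoulli 5 = 0 := bernoulli_eq_zero_of_odd (by decide) (by norm_num)

theorem coeffA_one_two_three_four :
    coeffA 1 = 1 / 12 ∧ coeffA 2 = 1 / 12 ∧ coeffA 3 = 109 / 720 ∧ coeffA 4 = 49 / 120 := by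
  norm_num [coeffA, stirlingS, Nat.stirlingFirst, Finset.sum_Icc_succ_top, Nat.factorial,
    bernoulli_three, bernoulli_four, bernoulli_five]

theorem coeffB_one_two_three_four :
    coeffB 1 = -(1 / 12) ∧ coeffB 2 = -(1 / 12) ∧ coeffB 3 = -(19 / 120) ∧
      coeffB 4 = -(9 / 20) := by
  norm_num [coeffB, stirlingS, Nat.stirlingFirst, Finset.sum_Icc_succ_top,
    bernoulli_three, bernoulli_four, bernoulli_five]

end SecondLogSum

/-- The series are indexed by `k = j + 1`, `j : ℕ`. The last eight equations are the displayed
leading terms of the two series. -/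
theorem mainTheorem9 (n : ℕ) (hn : 1 ≤ n) :
    Summable (fun j : ℕ => SecondLogSum.coeffA (j + 1) / SecondLogSum.risingProd n (j + 1)) ∧
    Summable (fun j : ℕ => SecondLogSum.coeffB (j + 1) / SecondLogSum.risingProd n (j + 1)) ∧
    ((∑ k ∈ Finset.Icc 1 n, Real.log k / k) =
      1 / 2 * Real.log n ^ 2 + Real.log n / (2 * n) + SecondLogSum.stieltjesOne
        + ∑' j : ℕ, SecondLogSum.coeffA (j + 1) / SecondLogSum.risingProd n (j + 1)
        + Real.log n *
          ∑' j : ℕ, SecondLogSum.coeffB (j + 1) / SecondLogSum.risingProd n (j + 1)) ∧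
    (SecondLogSum.coeffA 1 = 1 / 12 ∧ SecondLogSum.coeffA 2 = 1 / 12 ∧
      SecondLogSum.coeffA 3 = 109 / 720 ∧ SecondLogSum.coeffA 4 = 49 / 120) ∧
    (SecondLogSum.coeffB 1 = -(1 / 12) ∧ SecondLogSum.coeffB 2 = -(1 / 12) ∧
      SecondLogSum.coeffB 3 = -(19 / 120) ∧ SecondLogSum.coeffB 4 = -(9 / 20)) := by
  have ha : (1 : ℝ) ≤ n := by exact_mod_cast hn
  have hA := SecondLogSum.hasSum_coeffA_div_ascPochhammer ha
  have hB := SecondLogSum.hasSum_coeffB_div_ascPochhammer ha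
  simp only [← SecondLogSum.risingProd_eq_ascPochhammer_eval] at hA hB
  refine ⟨hA.summable, hB.summable, ?_, SecondLogSum.coeffA_one_two_three_four,
    SecondLogSum.coeffB_one_two_three_four⟩
  have hformula := SecondLogSum.stieltjesOneSeq_eq hn
  rw [SecondLogSum.stieltjesOneSeq, SecondLogSum.abelPlanaCorrection_log_div_eq_add ha,
    ← hA.tsum_eq, ← hB.tsum_eq] at hformula
  linarith
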